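/- **Setting.** Let $\alpha=(\alpha_i)_{i\in\mathbb Z}$, $\beta=(\beta_i)_{i\in\mathbb Z}$ be sequences of complex numbers, and $(\sigma^m\gamma)_i=\gamma_{i+m}$. Let $\mathfrak F$ be the fermionic Fock space with basis the semi-infinite monomials $v_{i_m}\wedge v_{i_{m-1}}\wedge\cdots$ ($i_m>i_{m-1}>\cdots$, $i_k=k$ for $k\ll0$), with creation operators $\psi_j=v_j\wedge\cdot$ and annihilation operators $\psi_j^*$ (contraction), so that $\psi_i\psi_j^*+\psi_j^*\psi_i=\delta_{ij}$; let $|\varnothing\rangle_m=v_m\wedge v_{m-1}\wedge\cdots$, and let ${:}\psi_i\psi_j^*{:}$ be $-\psi_j^*\psi_i$ if $i\le0$ and $\psi_i\psi_j^*$ if $i>0$. Put $$(z;\alpha)^k=\prod_{m=1}^k(1-z\alpha_m),\quad (z|\beta)^k=\prod_{m=1}^k(z-\beta_m)\quad(k\ge0),\qquad (z;\alpha)^k=\prod_{m=k+1}^0(1-z\alpha_m)^{-1},\quad (z|\beta)^k=\prod_{m=k+1}^0(z-\beta_m)^{-1}\quad(k<0).$$ For $k>0$ the deformed current operator is $J_k^{(\alpha;\beta)}=\sum_{i,j}A_{ij}^k\,{:}\psi_i\psi_j^*{:}$,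 where $A_{ij}^k$ is the coefficient of $z^{-k}$ in $$z\,\frac{(z|\beta)^{i-1}}{(z;\alpha)^{i}}\,(1-\alpha_j\beta_j)\frac{(z;\alpha)^{j-1}}{(z|\beta)^{j}},$$ the factors $(z-\beta_n)^{-1}$ being expanded in powers of $z^{-1}$ and the factors $(1-\alpha_nz)^{-1}$ in powers of $z$; that is, $A^k_{ij}=0$ for $i>j$, $A^k_{ii}=\beta_i^k$, and for $i<j$, $A^k_{ij}$ is $(1-\alpha_j\beta_j)$ times the coefficient of $x^k$ in $x\prod_{i<m<j}(x-\alpha_m)\prod_{i\le n\le j}(1-\beta_nx)^{-1}$. Let $\mathbf p=(p_1,p_2,\dots)$ be indeterminates, $H_+(\mathbf p|\alpha;\beta)=\sum_{k\ge1}\frac{p_k}{k}J_k^{(\alpha;\beta)}$, $\xi(\mathbf p;z)=\sum_{k\ge1}\frac{p_k}{k}z^k$ and $$\Lambda_m(\mathbf p|\beta)=\sum_{k\ge1}\frac{p_k}{k}\Bigl(\sum_{0<j\le m}\beta_j^k-\sum_{m<j\le0}\beta_j^k\Bigr).$$ For an integer vector $\lambda=(\lambda_1,\dots,\lambda_\ell)$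 put $|\lambda\rangle=\psi_{\lambda_1}\psi_{\lambda_2-1}\cdots\psi_{\lambda_\ell-\ell+1}|\varnothing\rangle_{-\ell}$ (for a partition, take $\ell=\ell(\lambda)$), let $\langle\lambda|$ be the dual vector for the pairing in which the semi-infinite monomials are orthonormal, and define the skew double factorial Schur functions $$s_{\lambda/\mu}(\mathbf p\|\alpha;\beta)=\langle\mu|e^{H_+(\mathbf p|\alpha;\beta)}|\lambda\rangle\in\mathbb C[[\mathbf p]],\qquad s_\lambda=s_{\lambda/\varnothing},\quad h_k=s_{(k)},\quad e_k=s_{(1^k)},$$ with $h_k=e_k=0$ for $k<0$. **Theorem.** Let $\lambda,\mu$ be partitions, with conjugates $\lambda',\mu'$, and let $n\ge0$ be an integer. 1. (Jacobi–Trudi) If $n\ge\ell(\lambda)$ and $n\ge\ell(\mu)$, then $$s_{\lambda/\mu}(\mathbf p\|\alpha;\beta)=e^{\Lambda_{-n}(\mathbf p|\beta)}\det\Bigl[e^{\xi(\mathbf p;\beta_{\mu_j-j+1})}\,h_{\lambda_i-\mu_j-i+j}\bigl(\mathbf p\|\sigma^{\mu_j-j+1}\alpha;\sigma^{\mu_j-j+1}\beta\bigr)\Bigr]_{i,j=1}^n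 .$$ 2. (dual Jacobi–Trudi, or Nägelsbach–Kostka) If $n\ge\lambda_1$ and $n\ge\mu_1$, then $$s_{\lambda/\mu}(\mathbf p\|\alpha;\beta)=e^{\Lambda_{n}(\mathbf p|\beta)}\det\Bigl[e^{-\xi(\mathbf p;\beta_{j-\mu'_j})}\,e_{\lambda'_i-\mu'_j-i+j}\bigl(\mathbf p\|\sigma^{j-\mu'_j-1}\alpha;\sigma^{j-\mu'_j-1}\beta\bigr)\Bigr]_{i,j=1}^n .$$ -/

import Mathlib

open Finset

noncomputable section

namespace DoubleFactorial

/-! ### Shifted powers and the coefficients of the deformed fermion fields -/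

/-- `(z;α)^k`: it is `∏_{m=1}^k (1 - z α_m)` for `k ≥ 0` and
`∏_{m=k+1}^0 (1 - z α_m)⁻¹` for `k < 0`. -/
def spow (α : ℤ → ℂ) (z : ℂ) (k : ℤ) : ℂ :=
  (∏ m ∈ Ioc 0 k, (1 - z * α m)) * (∏ m ∈ Ioc k 0, (1 - z * α m))⁻¹

/-- `(z|β)^k`: it is `∏_{m=1}^k (z - β_m)` for `k ≥ 0` and
`∏_{m=k+1}^0 (z - β_m)⁻¹` for `k < 0`. -/
def bpow (β : ℤ → ℂ) (z : ℂ) (k : ℤ) : ℂ :=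
  (∏ m ∈ Ioc 0 k, (z - β m)) * (∏ m ∈ Ioc k 0, (z - β m))⁻¹

/-- The coefficient of `ψ_i` in the deformed field `ψ(z|α;β)`. -/
def fieldCoeff (α β : ℤ → ℂ) (i : ℤ) (z : ℂ) : ℂ :=
  z * bpow β z (i - 1) / spow α z i

/-- The coefficient of `ψ_j^*` in the deformed field `ψ^*(z|α;β)`. -/
def dualFieldCoeff (α β : ℤ → ℂ) (j : ℤ) (z : ℂ) : ℂ :=
  (1 - α j * β j) * spow α z (j - 1) / bpow β z j

/-- The expansion in powers of `x` of
`x ∏_{i<m<j} (x - a_m) / ∏_{i≤n≤j} (1 - b_n x)`. -/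
def kernelSeries (a b : ℤ → ℂ) (i j : ℤ) : PowerSeries ℂ :=
  PowerSeries.X * (∏ m ∈ Ioo i j, (PowerSeries.X - PowerSeries.C (a m))) *
    ∏ n ∈ Icc i j, PowerSeries.mk (fun s => b n ^ s)

/-- `A_{ij}^k`, the coefficient of `z^{-k}` in the Laurent expansion of
`fieldCoeff α β i z * dualFieldCoeff α β j z`, with each `(z - β_n)⁻¹` expanded in powers of
`z⁻¹` and each `(1 - α_n z)⁻¹` in powers of `z`; see `hasSum_currentCoeff`. After the common
factors are cancelled, for `i < j` this is a power series in `z⁻¹`, for `j < i` a power series in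
`z`, and for `i = j` it is the two-sided geometric series. -/
def currentCoeff (α β : ℤ → ℂ) (k i j : ℤ) : ℂ :=
  if i < j then
    (if 0 ≤ k then (1 - α j * β j) * PowerSeries.coeff k.toNat (kernelSeries α β i j) else 0)
  else if j < i then
    (if k ≤ 0 then (1 - α j * β j) * PowerSeries.coeff (-k).toNat (kernelSeries β α j i) else 0)
  else
    (if 0 ≤ k then β i ^ k.toNat else α i ^ (-k).toNat)

/-! ### The fermionic Fock space -/

/-- The set of occupied sites of a semi-infinite monomial `v_{i_m} ∧ v_{i_{m-1}} ∧ ⋯`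
with `i_m > i_{m-1} > ⋯` and `i_k = k` for `k ≪ 0`: a set of integers that differs from the set of
nonpositive integers by finitely many elements. -/
def IsState (S : Set ℤ) : Prop := (S ∩ Set.Ioi 0).Finite ∧ (Set.Iic 0 \ S).Finite

/-- Semi-infinite monomials, written as sets of occupied sites. -/
abbrev State : Type := {S : Set ℤ // IsState S}

theorem IsState.insert {S : Set ℤ} (h : IsState S) (j : ℤ) : IsState (insert j S) := by
  refine ⟨(h.1.insert j).subset ?_, h.2.subset ?_⟩
  · rintro x ⟨hx | hx, h0⟩
    · exact Or.inl hx
    · exact Or.inr ⟨hx, h0⟩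
  · rintro x ⟨h0, hx⟩
    exact ⟨h0, fun h' => hx (Or.inr h')⟩

theorem IsState.erase {S : Set ℤ} (h : IsState S) (j : ℤ) : IsState (S \ {j}) := by
  refine ⟨h.1.subset ?_, (h.2.insert j).subset ?_⟩
  · rintro x ⟨hx, h0⟩
    exact ⟨hx.1, h0⟩
  · rintro x ⟨h0, hx⟩
    by_cases hj : x = j
    · exact Or.inl hj
    · exact Or.inr ⟨h0, fun h' => hx ⟨h', hj⟩⟩

theorem isState_Iic (m : ℤ) : IsState (Set.Iic m) := by
  constructor
  · exact (Set.finite_Ioc 0 m).subset fun x hx => ⟨hx.2, hx.1⟩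
  · exact (Set.finite_Ioc m 0).subset fun x hx => ⟨not_le.mp hx.2, hx.1⟩

/-- The fermionic Fock space, with basis the semi-infinite monomials. -/
abbrev Fock : Type := State →₀ ℂ

/-- The vacuum `|∅⟩_m = v_m ∧ v_{m-1} ∧ ⋯` of charge `m`. -/
def vacuum (m : ℤ) : Fock := Finsupp.single ⟨Set.Iic m, isState_Iic m⟩ 1

/-- The sign `(-1)^r`, where `r` is the number of occupied sites of `S` beyond `j`. -/
def stateSign (j : ℤ) (S : State) : ℂ := (-1) ^ (S.1 ∩ Set.Ioi j).ncard

open Classical in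
/-- The creation operator `ψ_j`, i.e. `v_j ∧ ·`. -/
def create (j : ℤ) : Module.End ℂ Fock :=
  Finsupp.linearCombination ℂ fun S : State =>
    if j ∈ S.1 then 0 else Finsupp.single ⟨insert j S.1, S.2.insert j⟩ (stateSign j S)

open Classical in
/-- The annihilation operator `ψ_j^*`, i.e. contraction with the dual vector of `v_j`. -/
def annihilate (j : ℤ) : Module.End ℂ Fock :=
  Finsupp.linearCombination ℂ fun S : State =>
    if j ∈ S.1 then Finsupp.single ⟨S.1 \ {j}, S.2.erase j⟩ (stateSign j S) else 0

/-- The normally ordered product `:ψ_i ψ_j^*:`. -/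
def normalOrd (i j : ℤ) : Module.End ℂ Fock :=
  if i ≤ 0 then -(annihilate j * create i) else create i * annihilate j

/-- The deformed current operator `J_k^{(α;β)} = ∑_{i,j} A_{ij}^k :ψ_i ψ_j^*:` for `k > 0`. On each
basis vector only finitely many terms are nonzero, see `finite_current_terms`. -/
def current (α β : ℤ → ℂ) (k : ℕ+) : Module.End ℂ Fock :=
  Finsupp.linearCombination ℂ fun S : State =>
    ∑ᶠ ij : ℤ × ℤ, currentCoeff α β k ij.1 ij.2 • normalOrd ij.1 ij.2 (Finsupp.single S 1)

/-- The canonical pairing, for which the semi-infinite monomials are orthonormal. -/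
def pairing (u v : Fock) : ℂ := u.sum fun S c => c * v S

/-! ### Power series in `p₁, p₂, …` -/

/-- `∑_{k ≥ 1} (p_k / k) c_k` as a power series in `p₁, p₂, …`; the `c_k` may be operators. -/
def pSum {A : Type*} [Ring A] [Algebra ℂ A] (c : ℕ+ → A) : MvPowerSeries ℕ+ A :=
  fun a => ∑ k ∈ a.support, if a = Finsupp.single k 1 then ((k : ℕ) : ℂ)⁻¹ • c k else 0

/-- The exponential `∑_N f^N / N!` of a power series without constant term; in a given degree only
the terms with `N` at most that degree contribute, see `coeff_pow_eq_zero`. -/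
def pExp {A : Type*} [Ring A] [Algebra ℂ A] (f : MvPowerSeries ℕ+ A) : MvPowerSeries ℕ+ A :=
  fun a => ∑ N ∈ range (a.degree + 1), ((N.factorial : ℂ))⁻¹ • MvPowerSeries.coeff a (f ^ N)

/-- `ξ(p;z) = ∑_{k ≥ 1} p_k z^k / k`. -/
def xi (z : ℂ) : MvPowerSeries ℕ+ ℂ := pSum fun k => z ^ (k : ℕ)

/-- `Λ_m(p|β) = ∑_{k ≥ 1} (p_k / k) Δ_m(k|β)` with
`Δ_m(k|β) = ∑_{0 < j ≤ m} β_j^k - ∑_{m < j ≤ 0} β_j^k`. -/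
def Lam (β : ℤ → ℂ) (m : ℤ) : MvPowerSeries ℕ+ ℂ :=
  pSum fun k => ∑ j ∈ Ioc 0 m, β j ^ (k : ℕ) - ∑ j ∈ Ioc m 0, β j ^ (k : ℕ)

/-- The deformed Hamiltonian `H_+(p|α;β) = ∑_{k ≥ 1} (p_k / k) J_k^{(α;β)}`. -/
def hamiltonian (α β : ℤ → ℂ) : MvPowerSeries ℕ+ (Module.End ℂ Fock) := pSum (current α β)

/-- The half vertex operator `e^{H_+(p|α;β)}`. -/
def halfVertex (α β : ℤ → ℂ) : MvPowerSeries ℕ+ (Module.End ℂ Fock) := pExp (hamiltonian α β)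

/-! ### Double factorial Schur functions -/

/-- `|λ⟩ = ψ_{λ_1} ψ_{λ_2-1} ⋯ ψ_{λ_n-n+1} |∅⟩_{-n}` for `λ ∈ ℤ^n` (indexed from `0` here). -/
def ket {n : ℕ} (l : Fin n → ℤ) : Fock :=
  (List.ofFn fun i : Fin n => create (l i - (i : ℕ))).prod (vacuum (-(n : ℤ)))

/-- The skew double factorial Schur function `s_{λ/μ}(p‖α;β) = ⟨μ| e^{H_+(p|α;β)} |λ⟩`. -/
def skewSchur {n m : ℕ} (l : Fin n → ℤ) (u : Fin m → ℤ) (α β : ℤ → ℂ) : MvPowerSeries ℕ+ ℂ :=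
  fun a => pairing (ket u) (MvPowerSeries.coeff a (halfVertex α β) (ket l))

/-- The double factorial Schur function `s_λ = s_{λ/∅}`. -/
def schur {n : ℕ} (l : Fin n → ℤ) (α β : ℤ → ℂ) : MvPowerSeries ℕ+ ℂ :=
  skewSchur l (Fin.elim0 : Fin 0 → ℤ) α β

/-- `h_k = s_{(k)}` (zero for `k < 0`, as `ψ_k |∅⟩_{-1} = 0` then). -/
def hFun (k : ℤ) (α β : ℤ → ℂ) : MvPowerSeries ℕ+ ℂ :=
  schur (fun _ : Fin 1 => k) α β

/-- `e_k = s_{(1^k)}` for `k ≥ 0`, and `e_k = 0` for `k < 0`. -/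
def eFun (k : ℤ) (α β : ℤ → ℂ) : MvPowerSeries ℕ+ ℂ :=
  if 0 ≤ k then schur (fun _ : Fin k.toNat => (1 : ℤ)) α β else 0

/-- The nonzero parts `(λ_1, …, λ_ℓ)` of a partition, as an integer vector of length `ℓ = ℓ(λ)`. -/
def parts (l : YoungDiagram) : Fin (l.colLen 0) → ℤ := fun i => (l.rowLen i : ℤ)

/-- The shift `σ^m`: `(σ^m γ)_i = γ_{i+m}`. -/
def shift (m : ℤ) (γ : ℤ → ℂ) : ℤ → ℂ := fun i => γ (i + m)

/-! ### Consistency of the definitions -/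

theorem coeff_pow_eq_zero {A : Type*} [Ring A] [Algebra ℂ A] (f : MvPowerSeries ℕ+ A)
    (hf : MvPowerSeries.coeff 0 f = 0) (N : ℕ) (a : ℕ+ →₀ ℕ) (h : a.degree < N) :
    MvPowerSeries.coeff a (f ^ N) = 0 := by
  induction N generalizing a with
  | zero => omega
  | succ N ih =>
    classical
    rw [pow_succ, MvPowerSeries.coeff_mul]
    refine Finset.sum_eq_zero fun x hx => ?_
    have hx' : x.1 + x.2 = a := by simpa using hx
    by_cases h2 : x.2 = 0
    · simp [h2, hf]
    · have hd : x.1.degree + x.2.degree = a.degree := by rw [← hx', map_add]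
      have : x.2.degree ≠ 0 := fun h0 => h2 ((Finsupp.degree_eq_zero_iff _).1 h0)
      rw [ih x.1 (by omega), zero_mul]

theorem coeff_zero_pSum {A : Type*} [Ring A] [Algebra ℂ A] (c : ℕ+ → A) :
    MvPowerSeries.coeff 0 (pSum c) = 0 := by
  simp [MvPowerSeries.coeff_apply, pSum]

theorem currentCoeff_eq_zero (α β : ℤ → ℂ) (k : ℕ+) (i j : ℤ) (h : j < i) :
    currentCoeff α β k i j = 0 := by
  have hk : (0 : ℤ) < ((k : ℕ) : ℤ) := by exact_mod_cast k.pos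
  have h0 : ¬ ((k : ℕ) : ℤ) ≤ 0 := not_le.2 hk
  simp only [currentCoeff, if_neg (not_lt.2 h.le), if_pos h, if_neg h0]

theorem create_single (j : ℤ) (S : State) (c : ℂ) (h : j ∈ S.1) :
    create j (Finsupp.single S c) = 0 := by
  simp [create, h]

theorem annihilate_single (j : ℤ) (S : State) (c : ℂ) (h : j ∉ S.1) :
    annihilate j (Finsupp.single S c) = 0 := by
  simp [annihilate, h]

theorem mem_of_normalOrd_ne_zero (i j : ℤ) (S : State)
    (h : normalOrd i j (Finsupp.single S 1) ≠ 0) :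
    (i ≤ 0 → i ∉ S.1 ∧ (j = i ∨ j ∈ S.1)) ∧ (0 < i → j ∈ S.1) := by
  refine ⟨fun hi => ?_, fun hi => ?_⟩
  · simp only [normalOrd, if_pos hi, LinearMap.neg_apply, Module.End.mul_apply] at h
    have hiS : i ∉ S.1 := fun hS => h (by rw [create_single i S 1 hS]; simp)
    refine ⟨hiS, ?_⟩
    by_contra hj
    apply h
    have : create i (Finsupp.single S 1) =
        Finsupp.single ⟨insert i S.1, S.2.insert i⟩ (stateSign i S) := by
      simp [create, hiS]
    rw [this, annihilate_single, neg_zero]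
    exact fun hm => hj hm
  · simp only [normalOrd, if_neg (not_le.2 hi), Module.End.mul_apply] at h
    by_contra hj
    exact h (by rw [annihilate_single j S 1 hj, map_zero])

/-- The sum defining `current` is finite on each basis vector. -/
theorem finite_current_terms (α β : ℤ → ℂ) (k : ℕ+) (S : State) :
    (Function.support fun ij : ℤ × ℤ =>
      currentCoeff α β k ij.1 ij.2 • normalOrd ij.1 ij.2 (Finsupp.single S 1)).Finite := by
  obtain ⟨U, hU⟩ := S.2.1.bddAbove
  obtain ⟨L, hL⟩ := S.2.2.bddBelow
  refine ((Set.finite_Icc (min L 0) (max U 0)).prod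
    (Set.finite_Icc (min L 0) (max U 0))).subset ?_
  rintro ⟨i, j⟩ hij
  rw [Function.mem_support] at hij
  have hA : currentCoeff α β k i j ≠ 0 := fun h0 => hij (by simp [h0])
  have hN : normalOrd i j (Finsupp.single S 1) ≠ 0 := fun h0 => hij (by simp [h0])
  have hle : i ≤ j := by
    by_contra hlt
    exact hA (currentCoeff_eq_zero α β k i j (not_le.1 hlt))
  obtain ⟨h1, h2⟩ := mem_of_normalOrd_ne_zero i j S hN
  have hU' : ∀ x ∈ S.1, 0 < x → x ≤ U := fun x hx h0 => hU ⟨hx, h0⟩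
  simp only [Set.mem_prod, Set.mem_Icc]
  rcases le_or_gt i 0 with hi | hi
  · obtain ⟨hiS, hj⟩ := h1 hi
    have hLi : L ≤ i := hL ⟨hi, hiS⟩
    have hjU : j ≤ max U 0 := by
      rcases hj with hj | hj
      · omega
      · rcases le_or_gt j 0 with h0 | h0
        · omega
        · have := hU' j hj h0
          omega
    omega
  · have := hU' j (h2 hi) (by omega)
    omega

theorem spow_mul_prod (α : ℤ → ℂ) (z : ℂ) (h : ∀ m, 1 - z * α m ≠ 0) {a b : ℤ} (hab : a ≤ b) :
    spow α z b = spow α z a * ∏ m ∈ Ioc a b, (1 - z * α m) := by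
  have key : ∀ c : ℤ, spow α z (c + 1) = spow α z c * (1 - z * α (c + 1)) := by
    intro c
    rcases le_or_gt 0 c with hc | hc
    · have e1 : Ioc 0 (c + 1) = insert (c + 1) (Ioc 0 c) := by ext x; simp; omega
      have e2 : Ioc (c + 1) 0 = ∅ := by simp; omega
      have e3 : Ioc c 0 = ∅ := by simp; omega
      simp only [spow]
      rw [e1, e2, e3, prod_insert (by simp)]
      ring
    · have e1 : Ioc c 0 = insert (c + 1) (Ioc (c + 1) 0) := by ext x; simp; omega
      have e2 : Ioc 0 (c + 1) = ∅ := by simp; omega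
      have e3 : Ioc 0 c = ∅ := by simp; omega
      simp only [spow]
      rw [e1, e2, e3, prod_insert (by simp), mul_inv]
      field_simp [h (c + 1)]
  induction b, hab using Int.leInduction with
  | base => simp
  | succ c hc ih =>
    have e1 : Ioc a (c + 1) = insert (c + 1) (Ioc a c) := by ext x; simp; omega
    rw [key, ih, e1, prod_insert (by simp)]
    ring

theorem bpow_mul_prod (β : ℤ → ℂ) (z : ℂ) (h : ∀ m, z - β m ≠ 0) {a b : ℤ} (hab : a ≤ b) :
    bpow β z b = bpow β z a * ∏ m ∈ Ioc a b, (z - β m) := by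
  have key : ∀ c : ℤ, bpow β z (c + 1) = bpow β z c * (z - β (c + 1)) := by
    intro c
    rcases le_or_gt 0 c with hc | hc
    · have e1 : Ioc 0 (c + 1) = insert (c + 1) (Ioc 0 c) := by ext x; simp; omega
      have e2 : Ioc (c + 1) 0 = ∅ := by simp; omega
      have e3 : Ioc c 0 = ∅ := by simp; omega
      simp only [bpow]
      rw [e1, e2, e3, prod_insert (by simp)]
      ring
    · have e1 : Ioc c 0 = insert (c + 1) (Ioc (c + 1) 0) := by ext x; simp; omega
      have e2 : Ioc 0 (c + 1) = ∅ := by simp; omega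
      have e3 : Ioc 0 c = ∅ := by simp; omega
      simp only [bpow]
      rw [e1, e2, e3, prod_insert (by simp), mul_inv]
      field_simp [h (c + 1)]
  induction b, hab using Int.leInduction with
  | base => simp
  | succ c hc ih =>
    have e1 : Ioc a (c + 1) = insert (c + 1) (Ioc a c) := by ext x; simp; omega
    rw [key, ih, e1, prod_insert (by simp)]
    ring

/-- The power series `f` converges absolutely at `x`, with sum `v`. -/
def AbsSum (x : ℂ) (f : PowerSeries ℂ) (v : ℂ) : Prop :=
  Summable (fun k => ‖PowerSeries.coeff k f * x ^ k‖) ∧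
    HasSum (fun k => PowerSeries.coeff k f * x ^ k) v

theorem AbsSum.of_eq {x : ℂ} {f : PowerSeries ℂ} {v : ℂ} (u : ℕ → ℂ)
    (e : ∀ k, PowerSeries.coeff k f * x ^ k = u k) (hu : Summable fun k => ‖u k‖)
    (hv : HasSum u v) : AbsSum x f v :=
  ⟨hu.congr fun k => by rw [e k], hv.congr_fun e⟩

theorem AbsSum.mul {x : ℂ} {f g : PowerSeries ℂ} {v w : ℂ} (hf : AbsSum x f v)
    (hg : AbsSum x g w) : AbsSum x (f * g) (v * w) := by
  have e : ∀ k, PowerSeries.coeff k (f * g) * x ^ k = ∑ kl ∈ antidiagonal k,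
      (PowerSeries.coeff kl.1 f * x ^ kl.1) * (PowerSeries.coeff kl.2 g * x ^ kl.2) := by
    intro k
    rw [PowerSeries.coeff_mul, sum_mul]
    refine sum_congr rfl fun kl hkl => ?_
    rw [← mem_antidiagonal.1 hkl, pow_add]
    ring
  have hs := summable_norm_sum_mul_antidiagonal_of_summable_norm hf.1 hg.1
  have ht := tsum_mul_tsum_eq_tsum_sum_antidiagonal_of_summable_norm hf.1 hg.1
  rw [hf.2.tsum_eq, hg.2.tsum_eq] at ht
  refine AbsSum.of_eq _ e hs ?_
  rw [ht]
  exact hs.of_norm.hasSum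

theorem AbsSum.C (x c : ℂ) : AbsSum x (PowerSeries.C c) c := by
  have hz : ∀ k, k ≠ 0 → PowerSeries.coeff k (PowerSeries.C c) * x ^ k = 0 := by
    intro k hk
    simp [PowerSeries.coeff_C, hk]
  refine ⟨summable_of_ne_finset_zero (s := {0}) fun k hk => ?_, ?_⟩
  · rw [hz k (by simpa using hk), norm_zero]
  · simpa using hasSum_single (f := fun k => PowerSeries.coeff k (PowerSeries.C c) * x ^ k) 0 hz

theorem AbsSum.X (x : ℂ) : AbsSum x PowerSeries.X x := by
  have hz : ∀ k, k ≠ 1 → PowerSeries.coeff k (PowerSeries.X : PowerSeries ℂ) * x ^ k = 0 := by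
    intro k hk
    simp [PowerSeries.coeff_X, hk]
  refine ⟨summable_of_ne_finset_zero (s := {1}) fun k hk => ?_, ?_⟩
  · rw [hz k (by simpa using hk), norm_zero]
  · simpa using hasSum_single
      (f := fun k => PowerSeries.coeff k (PowerSeries.X : PowerSeries ℂ) * x ^ k) 1 hz

theorem AbsSum.sub {x : ℂ} {f g : PowerSeries ℂ} {v w : ℂ} (hf : AbsSum x f v)
    (hg : AbsSum x g w) : AbsSum x (f - g) (v - w) := by
  exact AbsSum.of_eq _ (fun k => by rw [map_sub, sub_mul])
    ((hf.1.add hg.1).of_nonneg_of_le (fun _ => norm_nonneg _) fun _ => norm_sub_le _ _)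
    (hf.2.sub hg.2)

theorem AbsSum.geom (x b : ℂ) (h : ‖b * x‖ < 1) :
    AbsSum x (PowerSeries.mk fun s => b ^ s) (1 - b * x)⁻¹ := by
  exact AbsSum.of_eq (fun k => (b * x) ^ k) (fun k => by rw [PowerSeries.coeff_mk, mul_pow])
    ((summable_geometric_of_lt_one (norm_nonneg _) h).congr fun k => by simp only [norm_pow])
    (hasSum_geometric_of_norm_lt_one h)

theorem AbsSum.prod {x : ℂ} (s : Finset ℤ) (f : ℤ → PowerSeries ℂ) (v : ℤ → ℂ)
    (h : ∀ m, AbsSum x (f m) (v m)) : AbsSum x (∏ m ∈ s, f m) (∏ m ∈ s, v m) := by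
  classical
  induction s using Finset.induction_on with
  | empty => simpa using AbsSum.C x 1
  | insert a s ha ih => rw [prod_insert ha, prod_insert ha]; exact (h a).mul ih

theorem hasSum_kernelSeries (a b : ℤ → ℂ) (i j : ℤ) (x : ℂ) (h : ∀ m, ‖b m * x‖ < 1) :
    HasSum (fun k : ℕ => PowerSeries.coeff k (kernelSeries a b i j) * x ^ k)
      (x * (∏ m ∈ Ioo i j, (x - a m)) * ∏ n ∈ Icc i j, (1 - b n * x)⁻¹) :=
  (((AbsSum.X x).mul (AbsSum.prod _ _ _ fun m => (AbsSum.X x).sub (AbsSum.C x (a m)))).mul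
    (AbsSum.prod _ _ _ fun n => AbsSum.geom x (b n) (h n))).2

/-- On every circle that has all `β_n` inside and all `α_n⁻¹` outside, the coefficient of
`:ψ_i ψ_j^*:` in `:ψ(z|α;β) ψ^*(z|α;β):` equals `∑_k A_{ij}^k z^{-k}`. -/
theorem hasSum_currentCoeff (α β : ℤ → ℂ) (i j : ℤ) (z : ℂ) (hz : z ≠ 0)
    (hβ : ∀ m, ‖β m‖ < ‖z‖) (hα : ∀ m, ‖α m * z‖ < 1) :
    HasSum (fun k : ℤ => currentCoeff α β k i j * z ^ (-k))
      (fieldCoeff α β i z * dualFieldCoeff α β j z) := by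
  have hb : ∀ m, ‖β m * z⁻¹‖ < 1 := by
    intro m
    rw [norm_mul, norm_inv, ← div_eq_mul_inv, div_lt_one (norm_pos_iff.2 hz)]
    exact hβ m
  have hb0 : ∀ m, z - β m ≠ 0 := by
    intro m h0
    have := hβ m
    rw [← sub_eq_zero.1 h0] at this
    exact lt_irrefl _ this
  have ha0 : ∀ m, 1 - z * α m ≠ 0 := by
    intro m h0
    have := hα m
    rw [mul_comm, ← sub_eq_zero.1 h0, norm_one] at this
    exact lt_irrefl _ this
  have hs0 : ∀ k, spow α z k ≠ 0 := fun k =>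
    mul_ne_zero (prod_ne_zero_iff.2 fun m _ => ha0 m)
      (inv_ne_zero (prod_ne_zero_iff.2 fun m _ => ha0 m))
  have hp0 : ∀ k, bpow β z k ≠ 0 := fun k =>
    mul_ne_zero (prod_ne_zero_iff.2 fun m _ => hb0 m)
      (inv_ne_zero (prod_ne_zero_iff.2 fun m _ => hb0 m))
  rcases lt_trichotomy i j with hij | hij | hij
  · -- the case `i < j`
    have h := (hasSum_kernelSeries α β i j z⁻¹ hb).mul_left (1 - α j * β j)
    have hval : (1 - α j * β j) * (z⁻¹ * (∏ m ∈ Ioo i j, (z⁻¹ - α m)) *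
        ∏ n ∈ Icc i j, (1 - β n * z⁻¹)⁻¹) = fieldCoeff α β i z * dualFieldCoeff α β j z := by
      have e1 := spow_mul_prod α z ha0 (a := i) (b := j - 1) (by omega)
      have e2 := bpow_mul_prod β z hb0 (a := i - 1) (b := j) (by omega)
      have e3 : Ioc i (j - 1) = Ioo i j := by ext x; simp only [mem_Ioc, mem_Ioo]; omega
      have e4 : Ioc (i - 1) j = Icc i j := by ext x; simp only [mem_Ioc, mem_Icc]; omega
      rw [e3] at e1
      rw [e4] at e2
      have p1 : ∏ m ∈ Ioo i j, (1 - z * α m) =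
          z ^ (Ioo i j).card * ∏ m ∈ Ioo i j, (z⁻¹ - α m) := by
        rw [← prod_const, ← prod_mul_distrib]
        refine prod_congr rfl fun m _ => ?_
        field_simp
      have p2 : ∏ n ∈ Icc i j, (z - β n) =
          z ^ (Icc i j).card * ∏ n ∈ Icc i j, (1 - β n * z⁻¹) := by
        rw [← prod_const, ← prod_mul_distrib]
        refine prod_congr rfl fun m _ => ?_
        field_simp
      have hc : (Icc i j).card = (Ioo i j).card + 2 := by
        simp only [Int.card_Icc, Int.card_Ioo]
        omega
      have hne : ∏ n ∈ Icc i j, (1 - β n * z⁻¹) ≠ 0 := by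
        intro h0
        rw [h0, mul_zero] at p2
        exact prod_ne_zero_iff.2 (fun m _ => hb0 m) p2
      have hs := hs0 i
      have hp := hp0 (i - 1)
      rw [fieldCoeff, dualFieldCoeff, e1, e2, p1, p2, hc, prod_inv_distrib]
      generalize ∏ n ∈ Icc i j, (1 - β n * z⁻¹) = Q at hne ⊢
      generalize ∏ m ∈ Ioo i j, (z⁻¹ - α m) = R
      field_simp
      ring
    rw [hval] at h
    refine (Function.Injective.hasSum_iff (Nat.cast_injective (R := ℤ)) ?_).1 ?_
    · intro k hk
      have : ¬ 0 ≤ k := fun h0 => hk ⟨k.toNat, Int.toNat_of_nonneg h0⟩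
      simp [currentCoeff, hij, this]
    · refine h.congr_fun fun k => ?_
      simp [currentCoeff, hij, mul_assoc]
  · -- the case `i = j`
    subst hij
    have h1 := hasSum_geometric_of_norm_lt_one (hb i)
    have h2 := (hasSum_geometric_of_norm_lt_one (hα i)).mul_left (α i * z)
    have e1 := spow_mul_prod α z ha0 (a := i - 1) (b := i) (by omega)
    have e2 := bpow_mul_prod β z hb0 (a := i - 1) (b := i) (by omega)
    have e3 : Ioc (i - 1) i = {i} := by ext x; simp; omega
    rw [e3, prod_singleton] at e1 e2
    have hval : fieldCoeff α β i z * dualFieldCoeff α β i z =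
        (1 - β i * z⁻¹)⁻¹ + α i * z * (1 - α i * z)⁻¹ := by
      have hs := hs0 (i - 1)
      have hp := hp0 (i - 1)
      have h3 := ha0 i
      have h4 := hb0 i
      have h5 : 1 - α i * z ≠ 0 := by rwa [mul_comm] at h3
      have h6 : (1 - β i * z⁻¹)⁻¹ = z * (z - β i)⁻¹ := by
        rw [show z - β i = z * (1 - β i * z⁻¹) by field_simp, mul_inv]
        field_simp
      rw [fieldCoeff, dualFieldCoeff, e1, e2, h6, mul_comm z (α i)]
      field_simp
      ring
    rw [hval]
    refine HasSum.of_nat_of_neg_add_one ?_ ?_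
    · refine h1.congr_fun fun k => ?_
      simp [currentCoeff, mul_pow]
    · refine h2.congr_fun fun k => ?_
      have h3 : ¬ (0 : ℤ) ≤ -((k : ℤ) + 1) := by omega
      have h4 : ((k : ℤ) + 1).toNat = k + 1 := by omega
      simp only [currentCoeff, lt_irrefl, if_false, if_neg h3, neg_neg, h4]
      rw [show ((k : ℤ) + 1) = ((k + 1 : ℕ) : ℤ) by push_cast; rfl, zpow_natCast]
      ring
  · -- the case `j < i`
    have h := (hasSum_kernelSeries β α j i z hα).mul_left (1 - α j * β j)
    have hval : (1 - α j * β j) * (z * (∏ m ∈ Ioo j i, (z - β m)) *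
        ∏ n ∈ Icc j i, (1 - α n * z)⁻¹) = fieldCoeff α β i z * dualFieldCoeff α β j z := by
      have e1 := spow_mul_prod α z ha0 (a := j - 1) (b := i) (by omega)
      have e2 := bpow_mul_prod β z hb0 (a := j) (b := i - 1) (by omega)
      have e3 : Ioc j (i - 1) = Ioo j i := by ext x; simp only [mem_Ioc, mem_Ioo]; omega
      have e4 : Ioc (j - 1) i = Icc j i := by ext x; simp only [mem_Ioc, mem_Icc]; omega
      rw [e4] at e1
      rw [e3] at e2
      have hs := hs0 (j - 1)
      have hp := hp0 j
      have hne : ∏ n ∈ Icc j i, (1 - z * α n) ≠ 0 := prod_ne_zero_iff.2 fun m _ => ha0 m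
      have p : ∏ n ∈ Icc j i, (1 - α n * z)⁻¹ = (∏ n ∈ Icc j i, (1 - z * α n))⁻¹ := by
        rw [← prod_inv_distrib]
        exact prod_congr rfl fun n _ => by rw [mul_comm]
      rw [fieldCoeff, dualFieldCoeff, e1, e2, p]
      field_simp
    rw [hval] at h
    refine (Function.Injective.hasSum_iff
      (g := fun k : ℕ => -(k : ℤ)) (fun a b hab => by simpa using hab) ?_).1 ?_
    · intro k hk
      have : ¬ k ≤ 0 := fun h0 => hk ⟨(-k).toNat, by simp only; omega⟩
      simp [currentCoeff, not_lt.2 hij.le, hij, this]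
    · refine h.congr_fun fun k => ?_
      simp [currentCoeff, not_lt.2 hij.le, hij, mul_assoc]

end DoubleFactorial

end

open Finset

noncomputable section

namespace DoubleFactorial


/-! ### The Euler operator on power series -/

/-! Both determinants are instances of one Wick theorem for the exponential of a quadratic,
triangular Hamiltonian. For k > 0 the matrix A^k is upper triangular, so [J_k, ψ_b] = ∑_{i ≤ b}
A^k_{ib} ψ_i, and each vacuum is an eigenvector of J_k. Let θ = ∑ p_k ∂/∂p_k. Since H is a linear
form in p, θ e^H = e^H H, and this does not need the currents to commute. Hence, for a fixed bra,
the matrix elements of e^H on all kets ψ_{s_1}⋯ψ_{s_m}|∅⟩_c satisfy a linear system under θ. The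
series e^{Λ_c} det[E_{t_j s_i}], where θE = EA and E has constant term 1, satisfies the same system
with the same constant terms. Multiplying by a linear form raises the degree, so such a system has
only one solution (`eq_of_euler_system`). This is `IsTriangularCurrent.pairing_pExp`.

That theorem is stated for abstract anticommuting operators and is used twice. A partition is a set
of n particles over the vacuum of charge -n, at the sites λ_i - i, and also a set of n holes in the
vacuum of charge n, at the sites 1 - (λ'_j - j), with i and j counted from 0. Particles give the
first formula. Holes, with ψ*_{1-j} in the role of ψ_j, give the second.

The functions h_k and e_k are the 1×1 cases at charges -1 and 1. A shift of α and β moves an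
arbitrary row index of E to 0, and the factors e^{±ξ} in the determinants cancel the vacuum factors
contained in h_k and e_k. -/

theorem degree_sub_single {a : ℕ+ →₀ ℕ} {k : ℕ+} (hk : k ∈ a.support) :
    (a - Finsupp.single k 1).degree + 1 = a.degree := by
  have h1 : Finsupp.single k 1 ≤ a := by
    rw [Finsupp.single_le_iff]
    exact Nat.one_le_iff_ne_zero.2 (Finsupp.mem_support_iff.1 hk)
  conv_rhs => rw [← tsub_add_cancel_of_le h1]
  simp

theorem coeff_mul_pSum {A : Type*} [Ring A] [Algebra ℂ A] (f : MvPowerSeries ℕ+ A) (c : ℕ+ → A)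
    (a : ℕ+ →₀ ℕ) : MvPowerSeries.coeff a (f * pSum c) =
      ∑ k ∈ a.support, ((k : ℕ) : ℂ)⁻¹ •
        (MvPowerSeries.coeff (a - Finsupp.single k 1) f * c k) := by
  classical
  rw [MvPowerSeries.coeff_mul]
  symm
  have hs : ∀ k : ℕ+, MvPowerSeries.coeff (Finsupp.single k 1) (pSum c) =
      ((k : ℕ) : ℂ)⁻¹ • c k := by
    intro k
    simp [MvPowerSeries.coeff_apply, pSum]
  refine sum_of_injOn (fun k => (a - Finsupp.single k 1, Finsupp.single k 1)) ?_ ?_ ?_ ?_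
  · intro x _ y _ h
    simpa [Finsupp.single_left_inj] using congrArg Prod.snd h
  · intro k hk
    have h1 : Finsupp.single k 1 ≤ a := by
      rw [Finsupp.single_le_iff]
      exact Nat.one_le_iff_ne_zero.2 (Finsupp.mem_support_iff.1 hk)
    simpa using tsub_add_cancel_of_le h1
  · rintro ⟨x, y⟩ hxy hn
    have hxy' : x + y = a := by simpa using hxy
    have : MvPowerSeries.coeff y (pSum c) = 0 := by
      rw [MvPowerSeries.coeff_apply]
      refine sum_eq_zero fun k hk => if_neg fun hy => hn ⟨k, ?_, ?_⟩
      · subst hy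
        simp [← hxy']
      · simp [← hxy', hy]
    simp [this]
  · intro k _
    simp only [hs]
    rw [mul_smul_comm]

/-- A linear form is homogeneous of degree 1, so its N-th power is homogeneous of degree N. Only one
power therefore contributes to each coefficient of the exponential. -/
theorem coeff_pow_pSum {A : Type*} [Ring A] [Algebra ℂ A] (c : ℕ+ → A) (N : ℕ)
    (a : ℕ+ →₀ ℕ) (h : a.degree ≠ N) : MvPowerSeries.coeff a (pSum c ^ N) = 0 := by
  induction N generalizing a with
  | zero =>
    classical
    rw [pow_zero, MvPowerSeries.coeff_one, if_neg]
    rintro rfl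
    simp at h
  | succ N ih =>
    rw [pow_succ, coeff_mul_pSum]
    refine sum_eq_zero fun k hk => ?_
    rw [ih, zero_mul, smul_zero]
    have := degree_sub_single hk
    omega

theorem coeff_pExp_pSum {A : Type*} [Ring A] [Algebra ℂ A] (c : ℕ+ → A) (a : ℕ+ →₀ ℕ) :
    MvPowerSeries.coeff a (pExp (pSum c)) =
      ((a.degree.factorial : ℂ))⁻¹ • MvPowerSeries.coeff a (pSum c ^ a.degree) := by
  rw [MvPowerSeries.coeff_apply, pExp]
  refine sum_eq_single _ (fun N _ hN => ?_) fun h => ?_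
  · rw [coeff_pow_pSum c N a (Ne.symm hN), smul_zero]
  · simp at h

theorem coeff_zero_pExp {A : Type*} [Ring A] [Algebra ℂ A] (c : ℕ+ → A) :
    MvPowerSeries.coeff 0 (pExp (pSum c)) = 1 := by
  rw [coeff_pExp_pSum]
  simp

/-- The exponential of a linear form `f` satisfies `θ e^f = e^f f`, where `θ = ∑ p_k ∂/∂p_k`. -/
theorem degree_smul_coeff_pExp {A : Type*} [Ring A] [Algebra ℂ A] (c : ℕ+ → A) (a : ℕ+ →₀ ℕ) :
    (a.degree : ℂ) • MvPowerSeries.coeff a (pExp (pSum c)) =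
      MvPowerSeries.coeff a (pExp (pSum c) * pSum c) := by
  rcases eq_or_ne a 0 with rfl | ha
  · simp [coeff_mul_pSum]
  · obtain ⟨d, hd⟩ : ∃ d, a.degree = d + 1 :=
      Nat.exists_eq_succ_of_ne_zero fun h => ha ((Finsupp.degree_eq_zero_iff _).1 h)
    -- With f the linear form, degree d + 1 sees only f^(d+1)/(d+1)!. Splitting off the last factor
    -- f and using (d+1)/(d+1)! = 1/d! gives the claim, with no commutativity in `A`.
    rw [coeff_pExp_pSum, hd, pow_succ, coeff_mul_pSum, coeff_mul_pSum, smul_smul, smul_sum]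
    refine sum_congr rfl fun k hk => ?_
    have hk' := degree_sub_single hk
    have h : (a - Finsupp.single k 1).degree = d := by omega
    rw [coeff_pExp_pSum, h, smul_mul_assoc, smul_comm]
    congr 2
    rw [Nat.factorial_succ]
    push_cast
    have : (d : ℂ) + 1 ≠ 0 := by exact_mod_cast Nat.succ_ne_zero d
    field_simp

/-- The Euler operator `∑_k p_k ∂/∂p_k` as a linear map. -/
def eulerLinear : MvPowerSeries ℕ+ ℂ →ₗ[ℂ] MvPowerSeries ℕ+ ℂ where
  toFun f := fun a => (a.degree : ℂ) * MvPowerSeries.coeff a f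
  map_add' f g := by
    funext a
    exact mul_add (a.degree : ℂ) (f a) (g a)
  map_smul' r f := by
    funext a
    exact mul_left_comm (a.degree : ℂ) r (f a)

theorem coeff_eulerLinear (f : MvPowerSeries ℕ+ ℂ) (a : ℕ+ →₀ ℕ) :
    MvPowerSeries.coeff a (eulerLinear f) = (a.degree : ℂ) * MvPowerSeries.coeff a f := rfl

/-- The Euler operator `∑_k p_k ∂/∂p_k`. -/
def euler : Derivation ℂ (MvPowerSeries ℕ+ ℂ) (MvPowerSeries ℕ+ ℂ) :=
  Derivation.mk' eulerLinear fun f g => by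
    classical
    ext a
    rw [coeff_eulerLinear, smul_eq_mul, smul_eq_mul, mul_comm g, map_add, MvPowerSeries.coeff_mul,
      MvPowerSeries.coeff_mul, MvPowerSeries.coeff_mul, mul_sum, ← sum_add_distrib]
    refine sum_congr rfl fun x hx => ?_
    have hx' : x.1 + x.2 = a := by simpa using hx
    rw [coeff_eulerLinear, coeff_eulerLinear, ← hx', map_add]
    push_cast
    ring

theorem coeff_euler (f : MvPowerSeries ℕ+ ℂ) (a : ℕ+ →₀ ℕ) :
    MvPowerSeries.coeff a (euler f) = (a.degree : ℂ) * MvPowerSeries.coeff a f := rfl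

theorem euler_pExp (c : ℕ+ → ℂ) : euler (pExp (pSum c)) = pExp (pSum c) * pSum c := by
  ext a
  rw [coeff_euler, ← degree_smul_coeff_pExp, smul_eq_mul]

/-- Uniqueness for systems of linear equations `θ X_s = ∑_r X_{t_s(r)} 𝒜_{s,r}`. -/
theorem eq_of_euler_system {S R : Type*} (I : S → Finset R) (t : S → R → S)
    (A : S → R → ℕ+ → ℂ) (X Y : S → MvPowerSeries ℕ+ ℂ)
    (hX : ∀ s, euler (X s) = ∑ r ∈ I s, X (t s r) * pSum (A s r))
    (hY : ∀ s, euler (Y s) = ∑ r ∈ I s, Y (t s r) * pSum (A s r))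
    (h0 : ∀ s, MvPowerSeries.coeff 0 (X s) = MvPowerSeries.coeff 0 (Y s)) (s : S) :
    X s = Y s := by
  ext a
  obtain ⟨d, hd⟩ : ∃ d, a.degree = d := ⟨_, rfl⟩
  induction d generalizing a s with
  | zero =>
    obtain rfl := (Finsupp.degree_eq_zero_iff _).1 hd
    exact h0 s
  | succ d ih =>
    have hx := congrArg (MvPowerSeries.coeff a) (hX s)
    have hy := congrArg (MvPowerSeries.coeff a) (hY s)
    rw [coeff_euler, map_sum] at hx hy
    have hne : (a.degree : ℂ) ≠ 0 := by rw [hd]; exact_mod_cast Nat.succ_ne_zero d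
    refine mul_left_cancel₀ hne ?_
    rw [hx, hy]
    refine sum_congr rfl fun r _ => ?_
    rw [coeff_mul_pSum, coeff_mul_pSum]
    refine sum_congr rfl fun k hk => ?_
    have := degree_sub_single hk
    -- The right-hand sides involve only coefficients of degree d, though at other indices `t s r`;
    -- this is why the induction generalizes over `s`.
    rw [ih _ _ (by omega)]

/-! ### Additivity in the exponent and inverses of exponentials -/

theorem pSum_add {A : Type*} [Ring A] [Algebra ℂ A] (c d : ℕ+ → A) :
    pSum (fun k => c k + d k) = pSum c + pSum d := by
  ext a
  rw [map_add]
  simp only [MvPowerSeries.coeff_apply, pSum]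
  rw [← sum_add_distrib]
  refine sum_congr rfl fun k _ => ?_
  split_ifs <;> simp

theorem pSum_neg {A : Type*} [Ring A] [Algebra ℂ A] (c : ℕ+ → A) :
    pSum (fun k => -c k) = -pSum c := by
  rw [eq_neg_iff_add_eq_zero, ← pSum_add]
  ext a
  rw [map_zero]
  simp [MvPowerSeries.coeff_apply, pSum]

theorem pExp_neg_mul_pExp (c : ℕ+ → ℂ) :
    pExp (-pSum c) * pExp (pSum c) = 1 := by
  rw [← pSum_neg]
  -- The degenerate system θX = 0: a series killed by θ equals its constant term.
  refine eq_of_euler_system (S := Unit) (R := Unit) (fun _ => ∅) (fun _ _ => ()) (fun _ _ _ => 0)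
    (fun _ => pExp (pSum fun k => -c k) * pExp (pSum c)) (fun _ => 1) (fun _ => ?_) (fun _ => ?_)
    (fun _ => ?_) ()
  · rw [Derivation.leibniz, euler_pExp, euler_pExp, pSum_neg, sum_empty]
    simp only [smul_eq_mul]
    ring
  · simp
  · have h : ∀ c : ℕ+ → ℂ, MvPowerSeries.constantCoeff (pExp (pSum c)) = 1 := coeff_zero_pExp
    simp [h]

/-! ### Leibniz rules for products and determinants -/

theorem derivation_prod {ι R : Type*} [DecidableEq ι] [CommRing R] [Algebra ℂ R]
    (D : Derivation ℂ R R) (s : Finset ι) (f : ι → R) :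
    D (∏ j ∈ s, f j) = ∑ i ∈ s, ∏ j ∈ s, Function.update f i (D (f i)) j := by
  induction s using Finset.induction_on with
  | empty => simp
  | insert b s hb ih =>
    rw [prod_insert hb, Derivation.leibniz, ih, sum_insert hb, prod_insert hb, add_comm]
    congr 1
    · rw [Function.update_self, smul_eq_mul, mul_comm]
      congr 1
      exact prod_congr rfl fun j hj =>
        (Function.update_of_ne (ne_of_mem_of_not_mem hj hb) _ _).symm
    · rw [smul_eq_mul, mul_sum]
      refine sum_congr rfl fun i hi => ?_
      rw [prod_insert hb, Function.update_of_ne (ne_of_mem_of_not_mem hi hb).symm]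

theorem derivation_det {ι R : Type*} [DecidableEq ι] [Fintype ι] [CommRing R] [Algebra ℂ R]
    (D : Derivation ℂ R R) (M : Matrix ι ι R) :
    D M.det = ∑ i, (M.updateCol i fun j => D (M j i)).det := by
  simp only [Matrix.det_apply, map_sum]
  rw [sum_comm]
  refine sum_congr rfl fun σ _ => ?_
  rw [← smul_sum]
  have : D (Equiv.Perm.sign σ • ∏ i, M (σ i) i) = Equiv.Perm.sign σ • D (∏ i, M (σ i) i) := by
    rw [Units.smul_def, Units.smul_def, map_zsmul]
  rw [this, derivation_prod]
  congr 1
  refine sum_congr rfl fun i _ => prod_congr rfl fun j _ => ?_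
  by_cases h : j = i
  · subst h; simp
  · simp [h]

/-! ### Solutions of `θ E = E A` for triangular matrices `A` of linear forms -/

/-- The coefficients of the matrix exponential of `∑_k (p_k / k) A_k`, by degree. -/
def matExpCoeff (A : ℕ+ → ℤ → ℤ → ℂ) : ℕ → (ℕ+ →₀ ℕ) → ℤ → ℤ → ℂ
  | 0, _, i, j => if i = j then 1 else 0
  | d + 1, a, i, j => ((d + 1 : ℕ) : ℂ)⁻¹ * ∑ l ∈ Icc i j, ∑ k ∈ a.support, ((k : ℕ) : ℂ)⁻¹ *
      (matExpCoeff A d (a - Finsupp.single k 1) i l * A k l j)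

/-- The `(i, j)` entry of the exponential of the triangular matrix `∑_k (p_k / k) A_k`. -/
def matExp (A : ℕ+ → ℤ → ℤ → ℂ) (i j : ℤ) : MvPowerSeries ℕ+ ℂ :=
  fun a => matExpCoeff A a.degree a i j

theorem coeff_matExp (A : ℕ+ → ℤ → ℤ → ℂ) (i j : ℤ) (a : ℕ+ →₀ ℕ) :
    MvPowerSeries.coeff a (matExp A i j) = matExpCoeff A a.degree a i j := rfl

theorem matExp_eq_zero (A : ℕ+ → ℤ → ℤ → ℂ) {i j : ℤ} (h : j < i) : matExp A i j = 0 := by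
  ext a
  rw [coeff_matExp]
  rcases a.degree with _ | d
  · simp [matExpCoeff, h.ne']
  · simp [matExpCoeff, Icc_eq_empty (not_le.2 h)]

/-- The recursion for the coefficients is this equation read off in degree d + 1. The range `Icc i
j` keeps the product of infinite matrices finite. -/
theorem euler_matExp (A : ℕ+ → ℤ → ℤ → ℂ) (i j : ℤ) :
    euler (matExp A i j) = ∑ l ∈ Icc i j, matExp A i l * pSum fun k => A k l j := by
  ext a
  rw [coeff_euler, map_sum]
  obtain ⟨d, hd⟩ : ∃ d, a.degree = d := ⟨_, rfl⟩
  cases d with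
  | zero =>
    obtain rfl := (Finsupp.degree_eq_zero_iff _).1 hd
    simp [coeff_mul_pSum]
  | succ d =>
    rw [coeff_matExp, hd, matExpCoeff, mul_inv_cancel_left₀ (by exact_mod_cast Nat.succ_ne_zero d)]
    refine sum_congr rfl fun l _ => ?_
    rw [coeff_mul_pSum]
    refine sum_congr rfl fun k hk => ?_
    have h1 := degree_sub_single hk
    have h2 : (a - Finsupp.single k 1).degree = d := by omega
    rw [coeff_matExp, h2, smul_eq_mul]

/-- Makes the range of summation independent of the row, so that one sum over `l` serves a whole
column of a determinant. -/
theorem euler_matExp_Ioc (A : ℕ+ → ℤ → ℤ → ℂ) (i j : ℤ) {c : ℤ} (hc : c < i) :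
    euler (matExp A i j) = ∑ l ∈ Ioc c j, matExp A i l * pSum fun k => A k l j := by
  rw [euler_matExp]
  refine sum_subset (fun x hx => ?_) fun x hx hx' => ?_
  · rw [mem_Icc] at hx
    rw [mem_Ioc]
    omega
  · rw [mem_Icc] at hx'
    rw [mem_Ioc] at hx
    rw [matExp_eq_zero A (by omega), zero_mul]

theorem matExp_shift (A B : ℕ+ → ℤ → ℤ → ℂ) (c : ℤ)
    (h : ∀ k i j, B k i j = A k (i + c) (j + c)) (i j : ℤ) :
    matExp B i j = matExp A (i + c) (j + c) := by
  have key : ∀ d a i j, matExpCoeff B d a i j = matExpCoeff A d a (i + c) (j + c) := by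
    intro d
    induction d with
    | zero => intro a i j; simp [matExpCoeff]
    | succ d ih =>
      intro a i j
      simp only [matExpCoeff]
      congr 1
      rw [← Finset.map_add_right_Icc, sum_map]
      simp [ih, h]
  ext a
  rw [coeff_matExp, coeff_matExp, key]


/-! ### Creation and annihilation operators -/

open Classical in
theorem create_single_eq (j : ℤ) (S : State) (c : ℂ) :
    create j (Finsupp.single S c) = if j ∈ S.1 then 0 else
      Finsupp.single ⟨insert j S.1, S.2.insert j⟩ (c * stateSign j S) := by
  simp [create]

open Classical in
theorem annihilate_single_eq (j : ℤ) (S : State) (c : ℂ) :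
    annihilate j (Finsupp.single S c) = if j ∈ S.1 then
      Finsupp.single ⟨S.1 \ {j}, S.2.erase j⟩ (c * stateSign j S) else 0 := by
  simp [annihilate]

theorem finite_inter_Ioi (S : State) (j : ℤ) : (S.1 ∩ Set.Ioi j).Finite := by
  refine (S.2.1.union (Set.finite_Ioc j 0)).subset fun x hx => ?_
  rcases lt_or_ge 0 x with h | h
  · exact Or.inl ⟨hx.1, h⟩
  · exact Or.inr ⟨hx.2, h⟩

theorem stateSign_mul_self (j : ℤ) (S : State) : stateSign j S * stateSign j S = 1 := by
  rw [stateSign, ← mul_pow]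
  simp

theorem stateSign_congr (j : ℤ) (S T : State) (h : S.1 ∩ Set.Ioi j = T.1 ∩ Set.Ioi j) :
    stateSign j S = stateSign j T := by
  rw [stateSign, stateSign, h]

theorem stateSign_insert_of_le (i j : ℤ) (S : State) (h : j ≤ i) :
    stateSign i ⟨insert j S.1, S.2.insert j⟩ = stateSign i S := by
  refine stateSign_congr _ _ _ ?_
  ext x
  simp only [Set.mem_inter_iff, Set.mem_insert_iff, Set.mem_Ioi]
  constructor
  · rintro ⟨rfl | hx, h2⟩
    · omega
    · exact ⟨hx, h2⟩
  · rintro ⟨hx, h2⟩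
    exact ⟨Or.inr hx, h2⟩

theorem stateSign_insert_of_lt (i j : ℤ) (S : State) (h : i < j) (hj : j ∉ S.1) :
    stateSign i ⟨insert j S.1, S.2.insert j⟩ = -stateSign i S := by
  rw [stateSign, stateSign]
  have : insert j S.1 ∩ Set.Ioi i = insert j (S.1 ∩ Set.Ioi i) := by
    rw [Set.insert_inter_of_mem (Set.mem_Ioi.2 h)]
  simp only [this]
  rw [Set.ncard_insert_of_notMem (fun h => hj h.1) (finite_inter_Ioi S i), pow_succ]
  ring

theorem insert_erase_state (j : ℤ) (S : State) (h : j ∈ S.1) :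
    (⟨insert j (S.1 \ {j}), (S.2.erase j).insert j⟩ : State) = S := by
  apply Subtype.ext
  simp [Set.insert_eq_of_mem h]

theorem stateSign_erase_of_le (i j : ℤ) (S : State) (h : j ≤ i) (hj : j ∈ S.1) :
    stateSign i ⟨S.1 \ {j}, S.2.erase j⟩ = stateSign i S := by
  have := stateSign_insert_of_le i j ⟨S.1 \ {j}, S.2.erase j⟩ h
  rw [insert_erase_state j S hj] at this
  exact this.symm

theorem stateSign_erase_of_lt (i j : ℤ) (S : State) (h : i < j) (hj : j ∈ S.1) :
    stateSign i ⟨S.1 \ {j}, S.2.erase j⟩ = -stateSign i S := by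
  have := stateSign_insert_of_lt i j ⟨S.1 \ {j}, S.2.erase j⟩ h (by simp)
  rw [insert_erase_state j S hj] at this
  rw [this, neg_neg]

theorem end_ext {f g : Module.End ℂ Fock}
    (h : ∀ S : State, f (Finsupp.single S 1) = g (Finsupp.single S 1)) : f = g :=
  Finsupp.lhom_ext' fun S => LinearMap.ext_ring (h S)

theorem create_mul_create (i j : ℤ) : create i * create j = -(create j * create i) := by
  refine end_ext fun S => ?_
  simp only [Module.End.mul_apply, LinearMap.neg_apply, create_single_eq]
  rcases eq_or_ne i j with rfl | hij
  · by_cases hi : i ∈ S.1 <;> simp [hi, create_single_eq]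
  by_cases hi : i ∈ S.1 <;> by_cases hj : j ∈ S.1
  · simp [hi, hj]
  · simp [hi, hj, create_single_eq]
  · simp [hi, hj, create_single_eq]
  · simp only [hi, hj, if_false, create_single_eq, Set.mem_insert_iff, hij, hij.symm, or_self,
      one_mul]
    have e : insert i (insert j S.1) = insert j (insert i S.1) := Set.insert_comm _ _ _
    simp only [e]
    rw [← Finsupp.single_neg]
    congr 1
    -- The operator at the lower site sees one more occupied site when it acts second; the sign at
    -- the higher site does not change.
    rcases lt_or_gt_of_ne hij with h | h
    · rw [stateSign_insert_of_lt i j S h hj, stateSign_insert_of_le j i S h.le]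
      ring
    · rw [stateSign_insert_of_lt j i S h hi, stateSign_insert_of_le i j S h.le]
      ring

theorem annihilate_mul_annihilate (i j : ℤ) :
    annihilate i * annihilate j = -(annihilate j * annihilate i) := by
  refine end_ext fun S => ?_
  simp only [Module.End.mul_apply, LinearMap.neg_apply, annihilate_single_eq]
  rcases eq_or_ne i j with rfl | hij
  · by_cases hi : i ∈ S.1 <;> simp [hi, annihilate_single_eq]
  by_cases hi : i ∈ S.1 <;> by_cases hj : j ∈ S.1
  · simp only [hi, hj, if_true, annihilate_single_eq, Set.mem_sdiff, Set.mem_singleton_iff, hij,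
      hij.symm, not_false_eq_true, and_self, one_mul]
    have e : (S.1 \ {j}) \ {i} = (S.1 \ {i}) \ {j} := Set.sdiff_sdiff_comm
    simp only [e]
    rw [← Finsupp.single_neg]
    congr 1
    rcases lt_or_gt_of_ne hij with h | h
    · rw [stateSign_erase_of_lt i j S h hj, stateSign_erase_of_le j i S h.le hi]
      ring
    · rw [stateSign_erase_of_lt j i S h hi, stateSign_erase_of_le i j S h.le hj]
      ring
  · simp [hi, hj, annihilate_single_eq]
  · simp [hi, hj, annihilate_single_eq]
  · simp [hi, hj]

theorem annihilate_mul_create (i j : ℤ) :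
    annihilate i * create j + create j * annihilate i = if i = j then 1 else 0 := by
  refine end_ext fun S => ?_
  simp only [Module.End.mul_apply, LinearMap.add_apply, create_single_eq, annihilate_single_eq]
  rcases eq_or_ne i j with rfl | hij
  · by_cases hi : i ∈ S.1
    · have := insert_erase_state i S hi
      simp [hi, create_single_eq, stateSign_erase_of_le, stateSign_mul_self]
    · have e : (⟨insert i S.1 \ {i}, (S.2.insert i).erase i⟩ : State) = S := by
        apply Subtype.ext
        simp [hi]
      simp only [hi, if_false, annihilate_single_eq, Set.mem_insert_iff, true_or, if_true, e,
        stateSign_insert_of_le i i S le_rfl, one_mul, stateSign_mul_self, map_zero, add_zero,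
        Module.End.one_apply]
  · rw [if_neg hij, LinearMap.zero_apply]
    by_cases hi : i ∈ S.1 <;> by_cases hj : j ∈ S.1
    · simp [hi, hj, create_single_eq, hij.symm]
    · have e : insert j S.1 \ {i} = insert j (S.1 \ {i}) := by
        rw [Set.insert_sdiff_of_notMem]
        simpa using hij.symm
      simp only [hi, hj, if_true, if_false, annihilate_single_eq, create_single_eq,
        Set.mem_insert_iff, Set.mem_sdiff, or_true, false_and, one_mul, e]
      rw [← Finsupp.single_add, Finsupp.single_eq_zero]
      rcases lt_or_gt_of_ne hij with h | h
      · rw [stateSign_insert_of_lt i j S h hj, stateSign_erase_of_le j i S h.le hi]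
        ring
      · rw [stateSign_insert_of_le i j S h.le, stateSign_erase_of_lt j i S h hi]
        ring
    · simp [hi, hj]
    · simp [hi, hj, annihilate_single_eq, hij]

/-! ### The pairing -/

/-- The pairing as a bilinear map. -/
def pairingLin : Fock →ₗ[ℂ] Fock →ₗ[ℂ] ℂ :=
  Finsupp.linearCombination ℂ fun S : State => Finsupp.lapply S

theorem pairingLin_apply (u v : Fock) : pairingLin u v = pairing u v := by
  simp [pairingLin, pairing, Finsupp.linearCombination_apply, Finsupp.sum,
    LinearMap.sum_apply]

theorem pairingLin_single (S T : State) (c d : ℂ) :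
    pairingLin (Finsupp.single S c) (Finsupp.single T d) =
      c * (Finsupp.single T d : Fock) S := by
  simp [pairingLin]

/-- On basis vectors, filling j in S gives T exactly when emptying j in T gives S, and the sign at j
does not see the site j itself. -/
theorem pairing_create (j : ℤ) (u v : Fock) :
    pairingLin (create j u) v = pairingLin u (annihilate j v) := by
  classical
  have : pairingLin.comp (create j) = pairingLin.compl₂ (annihilate j) := by
    refine Finsupp.lhom_ext' fun S => LinearMap.ext_ring (Finsupp.lhom_ext' fun T =>
      LinearMap.ext_ring ?_)
    simp only [LinearMap.comp_apply, LinearMap.compl₂_apply, Finsupp.lsingle_apply]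
    rw [create_single_eq, annihilate_single_eq]
    by_cases hS : j ∈ S.1 <;> by_cases hT : j ∈ T.1
    · have : (⟨T.1 \ {j}, T.2.erase j⟩ : State) ≠ S := by
        rintro rfl
        simp at hS
      simp [hS, hT, pairingLin_single, this]
    · simp [hS, hT]
    · simp only [hS, hT, if_true, if_false, pairingLin_single, one_mul, Finsupp.single_apply]
      have hiff : T = (⟨insert j S.1, S.2.insert j⟩ : State) ↔
          (⟨T.1 \ {j}, T.2.erase j⟩ : State) = S := by
        constructor
        · rintro rfl
          apply Subtype.ext
          simp [hS]
        · rintro rfl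
          exact (insert_erase_state j T hT).symm
      by_cases h : T = (⟨insert j S.1, S.2.insert j⟩ : State)
      · rw [if_pos h, if_pos (hiff.1 h), h, stateSign_insert_of_le j j S le_rfl, mul_one]
      · rw [if_neg h, if_neg fun h' => h (hiff.2 h'), mul_zero]
    · have : T ≠ (⟨insert j S.1, S.2.insert j⟩ : State) := by
        rintro rfl
        simp at hT
      simp [hS, hT, pairingLin_single, this]
  exact LinearMap.congr_fun (LinearMap.congr_fun this u) v

theorem pairing_annihilate (j : ℤ) (u v : Fock) :
    pairingLin (annihilate j u) v = pairingLin u (create j v) := by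
  have symm : ∀ u v, pairingLin u v = pairingLin v u := by
    classical
    intro u v
    have : pairingLin = pairingLin.flip := by
      refine Finsupp.lhom_ext' fun S => LinearMap.ext_ring (Finsupp.lhom_ext' fun T =>
        LinearMap.ext_ring ?_)
      simp [pairingLin_single, Finsupp.single_apply, eq_comm]
    exact LinearMap.congr_fun (LinearMap.congr_fun this u) v
  rw [symm, ← pairing_create, symm]

theorem create_vacuum {j m : ℤ} (h : j ≤ m) : create j (vacuum m) = 0 :=
  create_single _ _ _ h

theorem annihilate_vacuum {j m : ℤ} (h : m < j) : annihilate j (vacuum m) = 0 :=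
  annihilate_single _ _ _ (by simpa using h)

theorem pairing_vacuum (m : ℤ) : pairingLin (vacuum m) (vacuum m) = 1 := by
  simp [vacuum, pairingLin_single]

theorem stateSign_vacuum (m : ℤ) (h : IsState (Set.Iic m)) :
    stateSign m ⟨Set.Iic m, h⟩ = 1 := by
  simp [stateSign, Set.Iic_inter_Ioi]

theorem annihilate_self_vacuum (m : ℤ) : annihilate m (vacuum m) = vacuum (m - 1) := by
  have e : (⟨Set.Iic m \ {m}, (isState_Iic m).erase m⟩ : State) =
      ⟨Set.Iic (m - 1), isState_Iic (m - 1)⟩ := by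
    apply Subtype.ext
    ext x
    simp [lt_iff_le_and_ne]
  rw [vacuum, annihilate_single_eq, if_pos (by simp), e, stateSign_vacuum, one_mul, vacuum]

theorem create_vacuum_self (m : ℤ) : create m (vacuum (m - 1)) = vacuum m := by
  have h := LinearMap.congr_fun (annihilate_mul_create m m) (vacuum m)
  rw [LinearMap.add_apply, Module.End.mul_apply, Module.End.mul_apply, create_vacuum le_rfl,
    annihilate_self_vacuum, map_zero, zero_add] at h
  simpa using h

/-! ### Currents -/

theorem current_single (α β : ℤ → ℂ) (k : ℕ+) (S : State) :
    current α β k (Finsupp.single S 1) = ∑ᶠ ij : ℤ × ℤ,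
      currentCoeff α β k ij.1 ij.2 • normalOrd ij.1 ij.2 (Finsupp.single S 1) := by
  simp [current]

/-- Extends the defining formula from basis vectors to all vectors. Finiteness is proved along with
it because additivity of `finsum` needs finite supports. -/
theorem current_apply_aux (α β : ℤ → ℂ) (k : ℕ+) (v : Fock) :
    (Function.support fun ij : ℤ × ℤ =>
      currentCoeff α β k ij.1 ij.2 • normalOrd ij.1 ij.2 v).Finite ∧
    current α β k v = ∑ᶠ ij : ℤ × ℤ,
      currentCoeff α β k ij.1 ij.2 • normalOrd ij.1 ij.2 v := by
  induction v using Finsupp.induction_linear with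
  | zero => simp
  | add u v hu hv =>
    simp only [map_add, smul_add]
    refine ⟨(hu.1.union hv.1).subset (Function.support_add _ _), ?_⟩
    rw [finsum_add_distrib hu.1 hv.1, hu.2, hv.2]
  | single S c =>
    have e : (Finsupp.single S c : Fock) = c • Finsupp.single S 1 := by simp
    simp only [e, map_smul, smul_comm _ c]
    refine ⟨(finite_current_terms α β k S).subset (Function.support_const_smul_subset c _), ?_⟩
    rw [current_single, smul_finsum' c (finite_current_terms α β k S)]

theorem finite_current_support (α β : ℤ → ℂ) (k : ℕ+) (v : Fock) :
    (Function.support fun ij : ℤ × ℤ =>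
      currentCoeff α β k ij.1 ij.2 • normalOrd ij.1 ij.2 v).Finite :=
  (current_apply_aux α β k v).1

theorem current_apply (α β : ℤ → ℂ) (k : ℕ+) (v : Fock) :
    current α β k v = ∑ᶠ ij : ℤ × ℤ,
      currentCoeff α β k ij.1 ij.2 • normalOrd ij.1 ij.2 v :=
  (current_apply_aux α β k v).2

/-- Normal ordering changes ψ_i ψ_j^* only by a scalar, which drops out of all commutators and
matters only for the vacuum eigenvalues. -/
theorem normalOrd_apply (i j : ℤ) (v : Fock) :
    normalOrd i j v = create i (annihilate j v) - (if j = i ∧ i ≤ 0 then (1 : ℂ) else 0) • v := by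
  have h := LinearMap.congr_fun (annihilate_mul_create j i) v
  simp only [LinearMap.add_apply, Module.End.mul_apply] at h
  rw [normalOrd]
  by_cases h1 : i ≤ 0
  · rw [if_pos h1, LinearMap.neg_apply, Module.End.mul_apply, eq_sub_of_add_eq h]
    by_cases h2 : j = i <;> simp [h1, h2]
  · simp [h1]

theorem normalOrd_create (i j b : ℤ) (v : Fock) :
    normalOrd i j (create b v) - create b (normalOrd i j v) = if j = b then create i v else 0 := by
  have h1 := LinearMap.congr_fun (annihilate_mul_create j b) v
  have h2 := LinearMap.congr_fun (create_mul_create b i) (annihilate j v)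
  simp only [LinearMap.add_apply, Module.End.mul_apply, LinearMap.neg_apply] at h1 h2
  rw [normalOrd_apply, normalOrd_apply, map_sub, map_smul, h2, eq_sub_of_add_eq h1, map_sub]
  by_cases h : j = b
  · rw [if_pos h, if_pos h, Module.End.one_apply]
    abel
  · rw [if_neg h, if_neg h, LinearMap.zero_apply, map_zero]
    abel

theorem normalOrd_annihilate (i j b : ℤ) (v : Fock) :
    normalOrd i j (annihilate b v) - annihilate b (normalOrd i j v) =
      if b = i then -annihilate j v else 0 := by
  have h1 := LinearMap.congr_fun (annihilate_mul_create b i) (annihilate j v)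
  have h2 := LinearMap.congr_fun (annihilate_mul_annihilate j b) v
  simp only [LinearMap.add_apply, Module.End.mul_apply, LinearMap.neg_apply] at h1 h2
  rw [normalOrd_apply, normalOrd_apply, map_sub, map_smul, h2, eq_sub_of_add_eq h1, map_neg]
  by_cases h : b = i
  · rw [if_pos h, if_pos h, Module.End.one_apply]
    abel
  · rw [if_neg h, if_neg h, LinearMap.zero_apply]
    abel

theorem finsum_ite_eq_sum {ι : Type*} (f : ι → Fock) (s : Finset ι) (h : ∀ x, x ∉ s → f x = 0) :
    ∑ᶠ x, f x = ∑ x ∈ s, f x :=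
  finsum_eq_sum_of_support_subset _ fun x hx => by
    by_contra hxs
    exact hx (h x hxs)

/-- Triangularity bounds the commutator sum above by b. It is unbounded below, and is cut off at c
because those ψ_i kill v. -/
theorem current_create (α β : ℤ → ℂ) (k : ℕ+) (b c : ℤ) (v : Fock)
    (hv : ∀ i ≤ c, create i v = 0) :
    current α β k (create b v) = create b (current α β k v) +
      ∑ i ∈ Ioc c b, currentCoeff α β k i b • create i v := by
  have hm : create b (current α β k v) = ∑ᶠ ij : ℤ × ℤ,
      currentCoeff α β k ij.1 ij.2 • create b (normalOrd ij.1 ij.2 v) := by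
    rw [current_apply, map_finsum _ (finite_current_support α β k v)]
    simp only [map_smul]
  have hf : (Function.support fun ij : ℤ × ℤ =>
      currentCoeff α β k ij.1 ij.2 • create b (normalOrd ij.1 ij.2 v)).Finite := by
    refine (finite_current_support α β k v).subset fun x hx h0 => hx ?_
    have := congrArg (create b) h0
    simpa only [map_smul, map_zero] using this
  rw [← sub_eq_iff_eq_add', hm, current_apply,
    ← finsum_sub_distrib (finite_current_support α β k _) hf]
  simp only [← smul_sub, normalOrd_create]
  rw [finsum_ite_eq_sum _ ((Ioc c b).map ⟨fun i => (i, b), Prod.mk_left_injective b⟩)]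
  · simp
  · rintro ⟨i, j⟩ hij
    by_cases hj : j = b
    · subst hj
      have : ¬ (c < i ∧ i ≤ j) := by simpa using hij
      rcases le_or_gt i c with h | h
      · simp [hv i h]
      · rw [currentCoeff_eq_zero α β k i j (by omega), zero_smul]
    · simp [hj]

theorem current_annihilate (α β : ℤ → ℂ) (k : ℕ+) (b c : ℤ) (v : Fock)
    (hv : ∀ j, c < j → annihilate j v = 0) :
    current α β k (annihilate b v) = annihilate b (current α β k v) +
      ∑ j ∈ Icc b c, (-currentCoeff α β k b j) • annihilate j v := by
  have hm : annihilate b (current α β k v) = ∑ᶠ ij : ℤ × ℤ,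
      currentCoeff α β k ij.1 ij.2 • annihilate b (normalOrd ij.1 ij.2 v) := by
    rw [current_apply, map_finsum _ (finite_current_support α β k v)]
    simp only [map_smul]
  have hf : (Function.support fun ij : ℤ × ℤ =>
      currentCoeff α β k ij.1 ij.2 • annihilate b (normalOrd ij.1 ij.2 v)).Finite := by
    refine (finite_current_support α β k v).subset fun x hx h0 => hx ?_
    have := congrArg (annihilate b) h0
    simpa only [map_smul, map_zero] using this
  rw [← sub_eq_iff_eq_add', hm, current_apply,
    ← finsum_sub_distrib (finite_current_support α β k _) hf]
  simp only [← smul_sub, normalOrd_annihilate]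
  rw [finsum_ite_eq_sum _ ((Icc b c).map ⟨fun j => (b, j), Prod.mk_right_injective b⟩)]
  · simp
  · rintro ⟨i, j⟩ hij
    by_cases hi : b = i
    · subst hi
      have : ¬ (b ≤ j ∧ j ≤ c) := by simpa using hij
      rcases lt_or_ge c j with h | h
      · simp [hv j h]
      · rw [currentCoeff_eq_zero α β k b j (by omega), zero_smul]
    · simp [hi]

/-- The eigenvalue of the `k`-th current on the vacuum of charge `m`. -/
def vacuumWeight (β : ℤ → ℂ) (m : ℤ) (k : ℕ+) : ℂ :=
  ∑ j ∈ Ioc 0 m, β j ^ (k : ℕ) - ∑ j ∈ Ioc m 0, β j ^ (k : ℕ)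

theorem currentCoeff_self (α β : ℤ → ℂ) (k : ℕ+) (i : ℤ) :
    currentCoeff α β k i i = β i ^ (k : ℕ) := by
  simp [currentCoeff]

theorem create_annihilate_vacuum {i j m : ℤ} (h : i ≤ j) :
    create i (annihilate j (vacuum m)) = if i = j ∧ j ≤ m then vacuum m else 0 := by
  rcases lt_or_ge m j with hj | hj
  · rw [annihilate_vacuum hj, map_zero, if_neg (by omega)]
  · have h1 := LinearMap.congr_fun (annihilate_mul_create j i) (vacuum m)
    simp only [LinearMap.add_apply, Module.End.mul_apply] at h1
    rw [create_vacuum (h.trans hj), map_zero, zero_add] at h1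
    rw [h1]
    by_cases hij : j = i
    · simp [hij, hij ▸ hj]
    · simp [hij, Ne.symm hij]

/-- For i < j the term ψ_i ψ_j^* kills the vacuum: either j is empty, or i is already filled. A
diagonal term contributes β_i^k times the occupation of i minus its occupation in the vacuum of
charge 0. -/
theorem current_vacuum (α β : ℤ → ℂ) (k : ℕ+) (m : ℤ) :
    current α β k (vacuum m) = vacuumWeight β m k • vacuum m := by
  have key : ∀ i j, currentCoeff α β k i j • normalOrd i j (vacuum m) =
      if i = j then ((if 0 < i ∧ i ≤ m then β i ^ (k : ℕ) else 0) -
        if m < i ∧ i ≤ 0 then β i ^ (k : ℕ) else 0) • vacuum m else 0 := by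
    intro i j
    rcases lt_or_ge j i with h | h
    · rw [currentCoeff_eq_zero α β k i j h, zero_smul, if_neg h.ne']
    · rw [normalOrd_apply, create_annihilate_vacuum h]
      by_cases hij : i = j
      · subst hij
        rw [currentCoeff_self]
        rcases le_or_gt i 0 with h1 | h1 <;> rcases le_or_gt i m with h2 | h2 <;>
          simp [h1, h2, not_lt.2, not_le.2]
      · simp [hij, Ne.symm hij]
  rw [current_apply]
  simp only [key]
  rw [finsum_ite_eq_sum _
    ((Ioc (min m 0) (max m 0)).image fun i => (i, i))]
  · rw [sum_image fun x _ y _ h => congrArg Prod.fst h]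
    simp only [if_true]
    rw [← sum_smul, vacuumWeight, sum_sub_distrib, ← sum_filter, ← sum_filter]
    congr 3
    · ext x
      simp
      omega
    · ext x
      simp
      omega
  · rintro ⟨i, j⟩ hij
    by_cases h : i = j
    · subst h
      have h' : ¬ (min m 0 < i ∧ i ≤ max m 0) := fun h =>
        hij (mem_image_of_mem (fun i => (i, i)) (mem_Ioc.2 h))
      rw [if_pos rfl, if_neg (by omega), if_neg (by omega), sub_zero, zero_smul]
    · rw [if_neg h]


/-! ### Wick's theorem for a fermion system with a triangular Hamiltonian -/

/-- The vector `c_{s_1} ⋯ c_{s_m} v`. -/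
def wedge (c : ℤ → Module.End ℂ Fock) {m : ℕ} (s : Fin m → ℤ) (v : Fock) : Fock :=
  (List.ofFn fun i => c (s i)).prod v

theorem wedge_zero (c : ℤ → Module.End ℂ Fock) (s : Fin 0 → ℤ) (v : Fock) : wedge c s v = v := by
  simp [wedge]

theorem wedge_succ (c : ℤ → Module.End ℂ Fock) {m : ℕ} (s : Fin (m + 1) → ℤ) (v : Fock) :
    wedge c s v = c (s 0) (wedge c (fun i => s i.succ) v) := by
  simp [wedge, List.ofFn_succ]

theorem ket_eq_wedge {n : ℕ} (l : Fin n → ℤ) :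
    ket l = wedge create (fun i => l i - (i : ℕ)) (vacuum (-(n : ℤ))) := rfl

/-- Operators `c_j`, `d_j` satisfying the canonical anticommutation relations and adjoint to each
other, with a normalized vacuum `v` killed by `c_j` for `j ≤ c₀` and by `d_j` for `j > c₀`. -/
structure IsFermionSystem (c d : ℤ → Module.End ℂ Fock) (v : Fock) (c₀ : ℤ) : Prop where
  anticomm : ∀ i j, c i * c j = -(c j * c i)
  car : ∀ i j, d i * c j + c j * d i = if i = j then 1 else 0
  adjoint : ∀ j u w, pairingLin (c j u) w = pairingLin u (d j w)
  create_vac : ∀ j ≤ c₀, c j v = 0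
  annihilate_vac : ∀ j, c₀ < j → d j v = 0
  norm_vac : pairingLin v v = 1

/-- Operators `J_k` with `J_k v = Λ_k v` and `[J_k, c_j] = ∑_i A^k_{ij} c_i`. -/
structure IsTriangularCurrent (c : ℤ → Module.End ℂ Fock) (v : Fock) (c₀ : ℤ)
    (J : ℕ+ → Module.End ℂ Fock) (A : ℕ+ → ℤ → ℤ → ℂ) (w : ℕ+ → ℂ) : Prop where
  vac : ∀ k, J k v = w k • v
  comm : ∀ k b u, (∀ i ≤ c₀, c i u = 0) →
    J k (c b u) = c b (J k u) + ∑ i ∈ Ioc c₀ b, A k i b • c i u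

section

variable {c d : ℤ → Module.End ℂ Fock} {v : Fock} {c₀ : ℤ}

theorem IsFermionSystem.create_wedge (h : IsFermionSystem c d v c₀) {m : ℕ} (s : Fin m → ℤ)
    {i : ℤ} (hi : i ≤ c₀) : c i (wedge c s v) = 0 := by
  induction m with
  | zero => rw [wedge_zero, h.create_vac i hi]
  | succ m ih =>
    have h1 := LinearMap.congr_fun (h.anticomm i (s 0)) (wedge c (fun i => s i.succ) v)
    rw [LinearMap.neg_apply, Module.End.mul_apply, Module.End.mul_apply, ih, map_zero,
      neg_zero] at h1
    rw [wedge_succ, h1]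

/-- Anticommute d_t to the right; it picks up a sign at each c_{s_i} passed and finally kills the
vacuum. -/
theorem IsFermionSystem.annihilate_wedge (h : IsFermionSystem c d v c₀) {m : ℕ}
    (s : Fin (m + 1) → ℤ) {t : ℤ} (ht : c₀ < t) :
    d t (wedge c s v) = ∑ i : Fin (m + 1), ((-1) ^ (i : ℕ) * if t = s i then (1 : ℂ) else 0) •
      wedge c (fun j => s (i.succAbove j)) v := by
  have h1 : ∀ u, d t (c (s 0) u) = (if t = s 0 then (1 : ℂ) else 0) • u - c (s 0) (d t u) := by
    intro u
    have h2 := LinearMap.congr_fun (h.car t (s 0)) u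
    rw [LinearMap.add_apply, Module.End.mul_apply, Module.End.mul_apply] at h2
    rw [eq_sub_of_add_eq h2]
    by_cases h3 : t = s 0 <;> simp [h3]
  rw [wedge_succ, h1, Fin.sum_univ_succ]
  simp only [Fin.val_zero, pow_zero, one_mul, Fin.succAbove_zero, sub_eq_add_neg]
  congr 1
  cases m with
  | zero => simp [wedge_zero, h.annihilate_vac t ht]
  | succ m =>
    rw [h.annihilate_wedge _ ht, map_sum, ← sum_neg_distrib]
    refine sum_congr rfl fun i _ => ?_
    rw [wedge_succ c (fun j => s (i.succ.succAbove j)), map_smul, ← neg_smul]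
    split_ifs <;> simp [pow_succ]

/-- Moving the first operator of the bra onto the ket is the Laplace expansion along the first row.
-/
theorem IsFermionSystem.pairing_wedge (h : IsFermionSystem c d v c₀) {m : ℕ}
    (t s : Fin m → ℤ) (ht : ∀ j, c₀ < t j) :
    pairingLin (wedge c t v) (wedge c s v) =
      (Matrix.of fun j i => if t j = s i then (1 : ℂ) else 0).det := by
  induction m with
  | zero => simp [wedge_zero, h.norm_vac]
  | succ m ih =>
    rw [wedge_succ c t, h.adjoint, h.annihilate_wedge s (ht 0), map_sum, Matrix.det_succ_row_zero]
    refine sum_congr rfl fun i _ => ?_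
    rw [map_smul, ih _ _ fun j => ht j.succ, smul_eq_mul]
    rfl

/-- J_k acts on a wedge product as a derivation, plus the vacuum eigenvalue. -/
theorem IsTriangularCurrent.apply_wedge (h : IsFermionSystem c d v c₀)
    {J : ℕ+ → Module.End ℂ Fock} {A : ℕ+ → ℤ → ℤ → ℂ} {w : ℕ+ → ℂ}
    (hJ : IsTriangularCurrent c v c₀ J A w) {m : ℕ} (s : Fin m → ℤ) (k : ℕ+) :
    J k (wedge c s v) = w k • wedge c s v + ∑ i, ∑ l ∈ Ioc c₀ (s i),
      A k l (s i) • wedge c (Function.update s i l) v := by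
  induction m with
  | zero => simp [wedge_zero, hJ.vac]
  | succ m ih =>
    rw [wedge_succ, hJ.comm k _ _ fun i hi => h.create_wedge _ hi, ih, map_add, map_smul,
      Fin.sum_univ_succ, add_assoc]
    congr 1
    rw [add_comm, map_sum]
    congr 1
    · refine sum_congr rfl fun l _ => ?_
      rw [wedge_succ]
      simp [Fin.succ_ne_zero]
    · refine sum_congr rfl fun i _ => ?_
      rw [map_sum]
      refine sum_congr rfl fun l _ => ?_
      rw [wedge_succ c (Function.update s i.succ l), map_smul,
        Function.update_of_ne (Fin.succ_ne_zero i).symm]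
      congr 3
      ext j
      by_cases hj : j = i
      · subst hj
        simp
      · simp [hj]

theorem degree_smul_coeff_pExp_apply (J : ℕ+ → Module.End ℂ Fock) (a : ℕ+ →₀ ℕ) (x : Fock) :
    (a.degree : ℂ) • MvPowerSeries.coeff a (pExp (pSum J)) x = ∑ k ∈ a.support,
      ((k : ℕ) : ℂ)⁻¹ •
        MvPowerSeries.coeff (a - Finsupp.single k 1) (pExp (pSum J)) (J k x) := by
  have h : (a.degree : ℂ) • MvPowerSeries.coeff a (pExp (pSum J)) = ∑ k ∈ a.support,
      ((k : ℕ) : ℂ)⁻¹ •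
        (MvPowerSeries.coeff (a - Finsupp.single k 1) (pExp (pSum J)) * J k) :=
    (degree_smul_coeff_pExp J a).trans (coeff_mul_pSum _ _ _)
  simpa only [LinearMap.smul_apply, LinearMap.sum_apply, Module.End.mul_apply] using
    LinearMap.congr_fun h x

/-- Wick's theorem. For fixed `t`, both sides satisfy the same system under θ as `s` varies: on the
left because J_k is a derivation on wedges, on the right by the Leibniz rule and θE = EA. -/
theorem IsTriangularCurrent.pairing_pExp (h : IsFermionSystem c d v c₀)
    {J : ℕ+ → Module.End ℂ Fock} {A : ℕ+ → ℤ → ℤ → ℂ} {w : ℕ+ → ℂ}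
    (hJ : IsTriangularCurrent c v c₀ J A w) {m : ℕ} (t s : Fin m → ℤ) (ht : ∀ j, c₀ < t j) :
    (fun a => pairing (wedge c t v) (MvPowerSeries.coeff a (pExp (pSum J)) (wedge c s v)) :
      MvPowerSeries ℕ+ ℂ) =
    pExp (pSum w) * (Matrix.of fun i j => matExp A (t j) (s i)).det := by
  set X : (Fin m → ℤ) → MvPowerSeries ℕ+ ℂ := fun s a =>
    pairing (wedge c t v) (MvPowerSeries.coeff a (pExp (pSum J)) (wedge c s v)) with hX
  have coeff_X : ∀ s a, MvPowerSeries.coeff a (X s) =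
      pairingLin (wedge c t v) (MvPowerSeries.coeff a (pExp (pSum J)) (wedge c s v)) :=
    fun s a => (pairingLin_apply _ _).symm
  -- Transposed so that changing one s_i changes one column, as in `derivation_det`.
  have hdet : (Matrix.of fun i j => matExp A (t j) (s i)).det =
      (Matrix.of fun j i => matExp A (t j) (s i)).det := by
    rw [← Matrix.det_transpose]
    rfl
  rw [hdet]
  -- The unknowns are indexed by all integer vectors, since replacing s_i by l need not keep them
  -- decreasing. `none` labels the vacuum term, and `some ⟨i, l⟩` the replacement of s_i by l.
  refine eq_of_euler_system (S := Fin m → ℤ) (R := Option (Σ _ : Fin m, ℤ))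
    (fun s => insertNone (univ.sigma fun i => Ioc c₀ (s i)))
    (fun s r => r.elim s fun r => Function.update s r.1 r.2)
    (fun s r => r.elim w fun r k => A k r.2 (s r.1)) X
    (fun s => pExp (pSum w) * (Matrix.of fun j i => matExp A (t j) (s i)).det)
    (fun s => ?_) (fun s => ?_) (fun s => ?_) s
  · rw [sum_insertNone, sum_sigma]
    simp only [Option.elim]
    ext a
    rw [coeff_euler, coeff_X, ← smul_eq_mul, ← map_smul, degree_smul_coeff_pExp_apply]
    simp only [coeff_mul_pSum, map_add, map_sum, map_smul, coeff_X, hJ.apply_wedge h, smul_add, smul_eq_mul,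
      sum_add_distrib, mul_sum]
    congr 1
    · exact sum_congr rfl fun k _ => by ring
    · rw [sum_comm]
      refine sum_congr rfl fun i _ => ?_
      rw [sum_comm]
      exact sum_congr rfl fun l _ => sum_congr rfl fun k _ => by ring
  · rw [sum_insertNone, sum_sigma, Derivation.leibniz, euler_pExp, derivation_det, add_comm]
    simp only [Option.elim, smul_eq_mul, mul_sum]
    congr 1
    · ring
    · refine sum_congr rfl fun i _ => ?_
      have key : ∀ l, (Matrix.of fun j i' => matExp A (t j) (Function.update s i l i')) =
          (Matrix.of fun j i' => matExp A (t j) (s i')).updateCol i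
            fun j => matExp A (t j) l := by
        intro l
        ext1 j i'
        by_cases hi : i' = i
        · subst hi
          simp
        · simp [hi]
      have hcol : (fun j => euler ((Matrix.of fun j i' => matExp A (t j) (s i')) j i)) =
          ∑ l ∈ Ioc c₀ (s i), (pSum fun k => A k l (s i)) • fun j => matExp A (t j) l := by
        funext j
        rw [Finset.sum_apply, Matrix.of_apply, euler_matExp_Ioc A _ _ (ht j)]
        exact sum_congr rfl fun l _ => mul_comm _ _
      simp only [key, hcol]
      -- Linearity of the determinant in column i, obtained as linearity in a row of the transpose.
      have hlin := map_sum ((Matrix.detRowAlternating (R := MvPowerSeries ℕ+ ℂ)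
        (n := Fin m)).toMultilinearMap.toLinearMap
          (Matrix.of fun j i' => matExp A (t j) (s i')).transpose i)
        (fun l => (pSum fun k => A k l (s i)) • fun j => matExp A (t j) l) (Ioc c₀ (s i))
      have hdet : ∀ u : Fin m → MvPowerSeries ℕ+ ℂ,
          (Matrix.detRowAlternating (R := MvPowerSeries ℕ+ ℂ)
            (n := Fin m)).toMultilinearMap.toLinearMap
            (Matrix.of fun j i' => matExp A (t j) (s i')).transpose i u =
          ((Matrix.of fun j i' => matExp A (t j) (s i')).updateCol i u).det := by
        intro u
        rw [← Matrix.det_transpose, ← Matrix.updateRow_transpose]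
        rfl
      rw [hdet] at hlin
      rw [hlin, mul_sum]
      refine sum_congr rfl fun l _ => ?_
      rw [map_smul, hdet, smul_eq_mul]
      ring
  · have h0 : MvPowerSeries.coeff 0 (pExp (pSum J)) = 1 := coeff_zero_pExp J
    rw [coeff_X, h0, Module.End.one_apply, h.pairing_wedge t s ht]
    have h1 : MvPowerSeries.constantCoeff (pExp (pSum w)) = 1 := coeff_zero_pExp w
    rw [MvPowerSeries.coeff_zero_eq_constantCoeff_apply, map_mul, h1, one_mul, RingHom.map_det]
    congr 1

end

/-! ### Particles and holes -/

theorem isFermionSystem_create (m : ℤ) :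
    IsFermionSystem create annihilate (vacuum m) m where
  anticomm := create_mul_create
  car := annihilate_mul_create
  adjoint := pairing_create
  create_vac _ h := create_vacuum h
  annihilate_vac _ h := annihilate_vacuum h
  norm_vac := pairing_vacuum m

/-- Particle–hole duality: the reflection j ↦ 1 - j exchanges filled and empty sites, so the vacuum
of charge m becomes one of charge -m for the holes. -/
theorem isFermionSystem_annihilate (m : ℤ) :
    IsFermionSystem (fun j => annihilate (1 - j)) (fun j => create (1 - j)) (vacuum m) (-m) where
  anticomm i j := annihilate_mul_annihilate _ _
  car i j := by
    have h := annihilate_mul_create (1 - j) (1 - i)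
    rw [add_comm, h]
    by_cases hij : i = j
    · simp [hij]
    · rw [if_neg hij, if_neg (by omega)]
  adjoint j := pairing_annihilate (1 - j)
  create_vac j h := annihilate_vacuum (by omega)
  annihilate_vac j h := create_vacuum (by omega)
  norm_vac := pairing_vacuum m

theorem isTriangularCurrent_create (α β : ℤ → ℂ) (m : ℤ) :
    IsTriangularCurrent create (vacuum m) m (current α β)
      (fun k i j => currentCoeff α β k i j) (vacuumWeight β m) where
  vac k := current_vacuum α β k m
  comm k b u hu := current_create α β k b m u hu

/-- The commutator with ψ^* brings minus the transpose of A, and the reflection makes that upper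
triangular again. -/
theorem isTriangularCurrent_annihilate (α β : ℤ → ℂ) (m : ℤ) :
    IsTriangularCurrent (fun j => annihilate (1 - j)) (vacuum m) (-m) (current α β)
      (fun k i j => -currentCoeff α β k (1 - j) (1 - i)) (vacuumWeight β m) where
  vac k := current_vacuum α β k m
  comm k b u hu := by
    rw [current_annihilate α β k (1 - b) m u fun j hj => by
      simpa using hu (1 - j) (by omega)]
    congr 1
    refine sum_bij' (fun j _ => 1 - j) (fun i _ => 1 - i) ?_ ?_ ?_ ?_ ?_
    · intro j hj
      rw [mem_Icc] at hj
      rw [mem_Ioc]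
      omega
    · intro j hj
      rw [mem_Ioc] at hj
      rw [mem_Icc]
      omega
    · intro j _
      omega
    · intro j _
      omega
    · intro j _
      simp

/-! ### Compatibility with shifts of the parameters -/

theorem currentCoeff_shift (α β : ℤ → ℂ) (c : ℤ) (k : ℕ+) (i j : ℤ) :
    currentCoeff (shift c α) (shift c β) k i j = currentCoeff α β k (i + c) (j + c) := by
  have hk : ∀ i j : ℤ, kernelSeries (shift c α) (shift c β) i j =
      kernelSeries α β (i + c) (j + c) := by
    intro i j
    rw [kernelSeries, kernelSeries, ← Finset.map_add_right_Icc, ← Finset.map_add_right_Ioo,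
      prod_map, prod_map]
    rfl
  rcases lt_or_ge j i with h | h
  · rw [currentCoeff_eq_zero _ _ _ _ _ h, currentCoeff_eq_zero _ _ _ _ _ (by omega)]
  · simp [currentCoeff, hk, shift]

/-- The entries of the exponential that describes the action on creation operators. -/
def particleExp (α β : ℤ → ℂ) : ℤ → ℤ → MvPowerSeries ℕ+ ℂ :=
  matExp fun k i j => currentCoeff α β k i j

/-- The entries of the exponential that describes the action on annihilation operators. -/
def holeExp (α β : ℤ → ℂ) : ℤ → ℤ → MvPowerSeries ℕ+ ℂ :=
  matExp fun k i j => -currentCoeff α β k (1 - j) (1 - i)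

theorem particleExp_shift (α β : ℤ → ℂ) (c i j : ℤ) :
    particleExp (shift c α) (shift c β) i j = particleExp α β (i + c) (j + c) :=
  matExp_shift _ _ c (fun k i j => currentCoeff_shift α β c k i j) i j

/-- The reflection j ↦ 1 - j reverses the direction of the shift. -/
theorem holeExp_shift (α β : ℤ → ℂ) (c i j : ℤ) :
    holeExp (shift c α) (shift c β) i j = holeExp α β (i - c) (j - c) := by
  refine matExp_shift _ _ (-c) (fun k i j => ?_) i j
  rw [currentCoeff_shift]
  congr 2 <;> ring


/-! ### Semi-infinite monomials of partitions -/

theorem isState_union_Iic {F : Set ℤ} (hF : F.Finite) (c : ℤ) : IsState (F ∪ Set.Iic c) := by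
  constructor
  · refine (hF.union (Set.finite_Ioc 0 c)).subset ?_
    rintro x ⟨hx | hx, h0⟩
    · exact Or.inl hx
    · exact Or.inr ⟨h0, hx⟩
  · refine (Set.finite_Ioc c 0).subset ?_
    rintro x ⟨h0, hx⟩
    exact ⟨not_le.1 fun h => hx (Or.inr h), h0⟩

/-- The sites are filled from the lowest up, so nothing lies beyond a new site and no sign appears.
-/
theorem wedge_create_eq {m : ℕ} (s : Fin m → ℤ) (hs : StrictAnti s) (c : ℤ) (hc : ∀ i, c < s i)
    (S : State) (hS : S.1 = Set.range s ∪ Set.Iic c) :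
    wedge create s (vacuum c) = Finsupp.single S 1 := by
  induction m generalizing S with
  | zero =>
    rw [wedge_zero, vacuum]
    congr 1
    exact Subtype.ext (by simp [hS])
  | succ m ih =>
    have hlt : ∀ i : Fin m, s i.succ < s 0 := fun i => hs (Fin.succ_pos i)
    have hmem : s 0 ∈ S.1 := by simp [hS]
    have h1 : S.1 \ {s 0} = Set.range (fun i : Fin m => s i.succ) ∪ Set.Iic c := by
      have h0 := hc 0
      ext x
      simp only [hS, Set.mem_sdiff, Set.mem_union, Set.mem_range, Set.mem_Iic,
        Set.mem_singleton_iff, Fin.exists_fin_succ]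
      constructor
      · rintro ⟨(h | h) | h, h2⟩
        · exact absurd h.symm h2
        · exact Or.inl h
        · exact Or.inr h
      · rintro (⟨i, rfl⟩ | h)
        · exact ⟨Or.inl (Or.inr ⟨i, rfl⟩), (hlt i).ne⟩
        · exact ⟨Or.inr h, by omega⟩
    rw [wedge_succ, ih _ (fun i j h => hs (Fin.succ_lt_succ_iff.2 h)) (fun i => hc i.succ)
      ⟨S.1 \ {s 0}, S.2.erase _⟩ h1, create_single_eq, if_neg (by simp), insert_erase_state _ _ hmem,
      one_mul]
    congr 1
    rw [stateSign]
    convert pow_zero _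
    rw [Set.ncard_eq_zero (finite_inter_Ioi _ _), Set.eq_empty_iff_forall_notMem]
    rintro x ⟨h, h2⟩
    replace h : x ∈ Set.range (fun i : Fin m => s i.succ) ∪ Set.Iic c := h1 ▸ h
    obtain ⟨i, rfl⟩ | h := h
    · exact lt_asymm (hlt i) h2
    · have := hc 0
      simp only [Set.mem_Iic, Set.mem_Ioi] at h h2
      omega

/-- Sites are emptied from the highest down. Beyond t_i there are c - t_i sites up to c, of which m
- 1 - i are already empty; `e i` counts the rest. -/
theorem wedge_annihilate_eq {m : ℕ} (t : Fin m → ℤ) (ht : StrictMono t) (c : ℤ)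
    (hc : ∀ i, t i ≤ c) (e : Fin m → ℕ) (he : ∀ i, (e i : ℤ) = c - t i - (m - 1 - (i : ℕ)))
    (S : State) (hS : S.1 = Set.Iic c \ Set.range t) :
    wedge annihilate t (vacuum c) = (-1 : ℂ) ^ (∑ i, e i) • Finsupp.single S 1 := by
  induction m generalizing S with
  | zero =>
    rw [wedge_zero, vacuum, univ_eq_empty, sum_empty, pow_zero, one_smul]
    congr 1
    exact Subtype.ext (by simp [hS])
  | succ m ih =>
    have hlt : ∀ i : Fin m, t 0 < t i.succ := fun i => ht (Fin.succ_pos i)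
    have hmem : t 0 ∉ S.1 := by simp [hS]
    have h1 : insert (t 0) S.1 = Set.Iic c \ Set.range (fun i : Fin m => t i.succ) := by
      have h0 := hc 0
      ext x
      simp only [hS, Set.mem_sdiff, Set.mem_insert_iff, Set.mem_range, Set.mem_Iic,
        Fin.exists_fin_succ, not_or, not_exists]
      constructor
      · rintro (rfl | ⟨h, -, h2⟩)
        · exact ⟨h0, fun i => (hlt i).ne'⟩
        · exact ⟨h, h2⟩
      · rintro ⟨h, h2⟩
        by_cases hx : x = t 0
        · exact Or.inl hx
        · exact Or.inr ⟨h, Ne.symm hx, h2⟩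
    have hS' : (⟨insert (t 0) S.1 \ {t 0}, (S.2.insert _).erase _⟩ : State) = S :=
      Subtype.ext (by simp [hmem])
    have hcard : (insert (t 0) S.1 ∩ Set.Ioi (t 0)).ncard = e 0 := by
      have h2 : insert (t 0) S.1 ∩ Set.Ioi (t 0) =
          ((Ioc (t 0) c \ univ.image fun i : Fin m => t i.succ : Finset ℤ) : Set ℤ) := by
        rw [h1]
        ext x
        simp
        tauto
      have h3 : univ.image (fun i : Fin m => t i.succ) ⊆ Ioc (t 0) c := by
        intro x hx
        obtain ⟨i, -, rfl⟩ := mem_image.1 hx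
        exact mem_Ioc.2 ⟨hlt i, hc _⟩
      have h4 : (univ.image fun i : Fin m => t i.succ).card = m := by
        rw [card_image_of_injective _ fun i j h => Fin.succ_injective _ (ht.injective h),
          card_univ, Fintype.card_fin]
      have h5 := card_le_card h3
      have h6 := he 0
      rw [h2, Set.ncard_coe_finset, card_sdiff_of_subset h3, h4, Int.card_Ioc]
      rw [h4, Int.card_Ioc] at h5
      push_cast at h6
      simp only [Fin.val_zero, Nat.cast_zero] at h6
      omega
    rw [wedge_succ, ih (fun i => t i.succ) (fun i j h => ht (Fin.succ_lt_succ_iff.2 h))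
      (fun i => hc i.succ) (fun i => e i.succ) (fun i => ?_)
      ⟨insert (t 0) S.1, S.2.insert _⟩ h1, map_smul, annihilate_single_eq, if_pos (by simp), hS',
      one_mul, stateSign, hcard, Fin.sum_univ_succ, Finsupp.smul_single, Finsupp.smul_single,
      pow_add]
    · congr 1
      simp [mul_comm]
    · rw [he i.succ]
      push_cast
      simp only [Fin.val_succ, Nat.cast_add, Nat.cast_one]
      ring

/-- The set of occupied sites `λ_i - i` of the semi-infinite monomial of a partition. -/
def maya (l : YoungDiagram) : Set ℤ := Set.range fun i : ℕ => (l.rowLen i : ℤ) - i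

theorem lt_rowLen_iff (l : YoungDiagram) (i j : ℕ) : j < l.rowLen i ↔ i < l.colLen j := by
  rw [← YoungDiagram.mem_iff_lt_rowLen, YoungDiagram.mem_iff_lt_colLen]

theorem maya_eq_union (l : YoungDiagram) {n : ℕ} (hn : l.colLen 0 ≤ n) :
    maya l = Set.range (fun i : Fin n => (l.rowLen i : ℤ) - (i : ℕ)) ∪ Set.Iic (-(n : ℤ)) := by
  have h0 : ∀ i, n ≤ i → l.rowLen i = 0 := by
    intro i hi
    by_contra h
    have := (lt_rowLen_iff l i 0).1 (Nat.pos_of_ne_zero h)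
    omega
  ext x
  constructor
  · rintro ⟨i, rfl⟩
    rcases lt_or_ge i n with h | h
    · exact Or.inl ⟨⟨i, h⟩, rfl⟩
    · refine Or.inr ?_
      simp only [h0 i h, Set.mem_Iic]
      omega
  · rintro (⟨i, rfl⟩ | h)
    · exact ⟨i, rfl⟩
    · rw [Set.mem_Iic] at h
      refine ⟨(-x).toNat, ?_⟩
      simp only
      rw [h0 _ (by omega)]
      omega

/-- Rows and columns give complementary sets of sites: along the boundary path of the diagram, each
step is either vertical (a row) or horizontal (a column). -/
theorem mem_maya_iff (l : YoungDiagram) (x : ℤ) :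
    x ∈ maya l ↔ ∀ j : ℕ, (j : ℤ) + 1 - l.colLen j ≠ x := by
  constructor
  · rintro ⟨i, rfl⟩ j h
    have := lt_rowLen_iff l i j
    simp only at h
    omega
  · intro h
    by_contra hx
    have hex : ∃ i : ℕ, (l.rowLen i : ℤ) - i ≤ x := by
      -- This row is empty, and its index is at least -x.
      refine ⟨l.colLen 0 + (-x).toNat, ?_⟩
      have := lt_rowLen_iff l (l.colLen 0 + (-x).toNat) 0
      push_cast
      omega
    classical
    have h1 := Nat.find_spec hex
    have h2 : ∀ i < Nat.find hex, ¬ (l.rowLen i : ℤ) - i ≤ x := fun i hi => Nat.find_min hex hi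
    generalize Nat.find hex = i at h1 h2
    -- Since i is the first row with λ_i - i ≤ x and equality is excluded, the column j = x + i - 1
    -- has length exactly i, so j + 1 - λ'_j = x.
    have h3 : (l.rowLen i : ℤ) - i ≠ x := fun h => hx ⟨i, h⟩
    have h4 := h (x + i - 1).toNat
    have h5 := lt_rowLen_iff l i (x + i - 1).toNat
    rcases Nat.eq_zero_or_pos i with rfl | hi
    · omega
    · have h6 := h2 (i - 1) (by omega)
      have h7 := lt_rowLen_iff l (i - 1) (x + i - 1).toNat
      omega

theorem maya_eq_diff (l : YoungDiagram) {n : ℕ} (hn : l.rowLen 0 ≤ n) :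
    maya l = Set.Iic (n : ℤ) \
      Set.range (fun j : Fin n => 1 - ((l.colLen j : ℤ) - (j : ℕ))) := by
  have h0 : ∀ j, n ≤ j → l.colLen j = 0 := by
    intro j hj
    by_contra h
    have := (lt_rowLen_iff l 0 j).2 (Nat.pos_of_ne_zero h)
    omega
  ext x
  rw [mem_maya_iff]
  simp only [Set.mem_sdiff, Set.mem_Iic, Set.mem_range, not_exists]
  constructor
  · intro h
    refine ⟨?_, fun j hj => h j (by omega)⟩
    by_contra hx
    have h1 := h (x - 1).toNat
    rw [h0 _ (by omega)] at h1
    omega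
  · rintro ⟨h, h1⟩ j hj
    rcases lt_or_ge j n with h2 | h2
    · have h3 := h1 ⟨j, h2⟩
      simp only at h3
      omega
    · rw [h0 j h2] at hj
      omega

theorem isState_maya (l : YoungDiagram) : IsState (maya l) := by
  rw [maya_eq_union l le_rfl]
  exact isState_union_Iic (Set.finite_range _) _

theorem wedge_rows (l : YoungDiagram) {n : ℕ} (hn : l.colLen 0 ≤ n) :
    wedge create (fun i : Fin n => (l.rowLen i : ℤ) - (i : ℕ)) (vacuum (-(n : ℤ))) =
      Finsupp.single ⟨maya l, isState_maya l⟩ 1 := by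
  refine wedge_create_eq _ (fun i j h => ?_) _ (fun i => ?_) _ (maya_eq_union l hn)
  · have h1 := l.rowLen_anti i j (Fin.le_def.1 h.le)
    have h2 := Fin.lt_def.1 h
    omega
  · have := i.2
    omega

/-- When the hole of column i is made, exactly λ'_i filled sites lie beyond it; the total sign is
(-1)^|λ|. -/
theorem wedge_columns (l : YoungDiagram) {n : ℕ} (hn : l.rowLen 0 ≤ n) :
    wedge (fun j => annihilate (1 - j)) (fun i : Fin n => (l.colLen i : ℤ) - (i : ℕ))
      (vacuum (n : ℤ)) =
      (-1 : ℂ) ^ (∑ i : Fin n, l.colLen i) •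
        Finsupp.single ⟨maya l, isState_maya l⟩ 1 := by
  refine wedge_annihilate_eq (fun i : Fin n => 1 - ((l.colLen i : ℤ) - (i : ℕ)))
    (fun i j h => ?_) _ (fun i => ?_) (fun i => l.colLen i) (fun i => ?_) _ (maya_eq_diff l hn)
  · have h1 := l.colLen_anti i j (Fin.le_def.1 h.le)
    have h2 := Fin.lt_def.1 h
    simp only
    omega
  · have := i.2
    omega
  · omega

/-! ### The kets of partitions, of the vacuum and of single columns as wedges -/

theorem ket_parts (l : YoungDiagram) :
    ket (parts l) = Finsupp.single ⟨maya l, isState_maya l⟩ 1 :=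
  wedge_rows l le_rfl

theorem ket_elim0 : ket (Fin.elim0 : Fin 0 → ℤ) = vacuum 0 := by
  rw [ket_eq_wedge, wedge_zero]
  rfl

theorem vacuum_eq_wedge_create :
    vacuum 0 = wedge create (fun _ : Fin 1 => 0) (vacuum (-1)) := by
  rw [wedge_succ, wedge_zero]
  exact (create_vacuum_self 0).symm

theorem vacuum_eq_wedge_annihilate :
    vacuum 0 = wedge (fun j => annihilate (1 - j)) (fun _ : Fin 1 => 0) (vacuum 1) := by
  rw [wedge_succ, wedge_zero]
  exact (annihilate_self_vacuum 1).symm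

/-- A column of length k is the vacuum of charge 1 with one hole at 1 - k, beyond which lie k filled
sites. -/
theorem ket_column (k : ℕ) : ket (fun _ : Fin k => (1 : ℤ)) =
    (-1 : ℂ) ^ k • wedge (fun j => annihilate (1 - j)) (fun _ : Fin 1 => (k : ℤ)) (vacuum 1) := by
  have hS : Set.range (fun i : Fin k => (1 : ℤ) - (i : ℕ)) ∪ Set.Iic (-(k : ℤ)) =
      Set.Iic 1 \ Set.range fun _ : Fin 1 => 1 - (k : ℤ) := by
    ext x
    simp only [Set.mem_union, Set.mem_range, Set.mem_Iic, Set.mem_sdiff, exists_const]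
    constructor
    · rintro (⟨i, rfl⟩ | h)
      · have := i.2
        omega
      · omega
    · rintro ⟨h1, h2⟩
      by_cases h : x ≤ -k
      · exact Or.inr h
      · refine Or.inl ⟨⟨(1 - x).toNat, by omega⟩, ?_⟩
        simp only
        omega
  have h1 := wedge_create_eq (fun i : Fin k => (1 : ℤ) - (i : ℕ))
    (fun i j h => by have := Fin.lt_def.1 h; simp only; omega) (-(k : ℤ))
    (fun i => by have := i.2; omega)
    ⟨_, isState_union_Iic (Set.finite_range _) _⟩ rfl
  have h2 := wedge_annihilate_eq (fun _ : Fin 1 => 1 - (k : ℤ)) (Subsingleton.strictMono _) 1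
    (fun _ => by omega) (fun _ => k) (fun i => by simp)
    ⟨_, isState_union_Iic (Set.finite_range _) _⟩ hS
  rw [ket_eq_wedge, h1]
  refine Eq.trans ?_ (congrArg (fun v => (-1 : ℂ) ^ k • v) h2.symm)
  simp only [univ_unique, sum_const, card_singleton, one_smul, smul_smul]
  rw [← mul_pow]
  simp

/-! ### Matrix elements of the half vertex operator -/

/-- The matrix element `⟨u| e^{H_+(p|α;β)} |v⟩`. -/
def vertexElement (u v : Fock) (α β : ℤ → ℂ) : MvPowerSeries ℕ+ ℂ :=
  fun a => pairing u (MvPowerSeries.coeff a (halfVertex α β) v)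

theorem skewSchur_eq {n m : ℕ} (l : Fin n → ℤ) (u : Fin m → ℤ) (α β : ℤ → ℂ) :
    skewSchur l u α β = vertexElement (ket u) (ket l) α β := rfl

theorem vertexElement_smul_smul (u v : Fock) (p q : ℕ) (α β : ℤ → ℂ) :
    vertexElement ((-1 : ℂ) ^ p • u) ((-1 : ℂ) ^ q • v) α β =
      (-1) ^ p * (-1) ^ q * vertexElement u v α β := by
  have h : vertexElement ((-1 : ℂ) ^ p • u) ((-1 : ℂ) ^ q • v) α β =
      ((-1 : ℂ) ^ p * (-1) ^ q) • vertexElement u v α β := by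
    funext a
    have h1 : ∀ u v, vertexElement u v α β a =
        pairingLin u (MvPowerSeries.coeff a (halfVertex α β) v) :=
      fun u v => (pairingLin_apply _ _).symm
    change _ = ((-1 : ℂ) ^ p * (-1) ^ q) * vertexElement u v α β a
    rw [h1, h1, map_smul, map_smul, map_smul, LinearMap.smul_apply, smul_eq_mul, smul_eq_mul]
    ring
  rw [h, Algebra.smul_def]
  simp

theorem vertexElement_create (α β : ℤ → ℂ) {m : ℕ} (t s : Fin m → ℤ) (c : ℤ)
    (ht : ∀ j, c < t j) :
    vertexElement (wedge create t (vacuum c)) (wedge create s (vacuum c)) α β =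
      pExp (Lam β c) * (Matrix.of fun i j => particleExp α β (t j) (s i)).det :=
  (isTriangularCurrent_create α β c).pairing_pExp (isFermionSystem_create c) t s ht

theorem vertexElement_annihilate (α β : ℤ → ℂ) {m : ℕ} (t s : Fin m → ℤ) (c : ℤ)
    (ht : ∀ j, -c < t j) :
    vertexElement (wedge (fun j => annihilate (1 - j)) t (vacuum c))
        (wedge (fun j => annihilate (1 - j)) s (vacuum c)) α β =
      pExp (Lam β c) * (Matrix.of fun i j => holeExp α β (t j) (s i)).det :=
  (isTriangularCurrent_annihilate α β c).pairing_pExp (isFermionSystem_annihilate c) t s ht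

/-! ### The functions h_k and e_k as 1×1 determinants -/

theorem Lam_neg_one (β : ℤ → ℂ) : Lam β (-1) = -xi (β 0) := by
  have h1 : Ioc (-1 : ℤ) 0 = {0} := rfl
  rw [xi, ← pSum_neg, Lam]
  simp [h1]

theorem Lam_one (β : ℤ → ℂ) : Lam β 1 = xi (β 1) := by
  have h1 : Ioc (0 : ℤ) 1 = {1} := rfl
  rw [xi, Lam]
  simp [h1]

theorem pExp_neg_xi_mul_pExp_xi (z : ℂ) : pExp (-xi z) * pExp (xi z) = 1 :=
  pExp_neg_mul_pExp _

theorem hFun_eq (k : ℤ) (α β : ℤ → ℂ) :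
    hFun k α β = pExp (-xi (β 0)) * particleExp α β 0 k := by
  have h : ket (fun _ : Fin 1 => k) = wedge create (fun _ : Fin 1 => k) (vacuum (-1)) := by
    rw [ket_eq_wedge, wedge_succ, wedge_succ, wedge_zero, wedge_zero]
    simp
  rw [hFun, schur, skewSchur_eq, ket_elim0, vacuum_eq_wedge_create, h,
    vertexElement_create _ _ _ _ _ fun _ => by omega, Lam_neg_one, Matrix.det_unique,
    Matrix.of_apply]

theorem eFun_eq (k : ℤ) (α β : ℤ → ℂ) :
    eFun k α β = (-1) ^ k.toNat * (pExp (xi (β 1)) * holeExp α β 0 k) := by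
  rw [eFun]
  split_ifs with hk
  · obtain ⟨k, rfl⟩ := Int.eq_ofNat_of_zero_le hk
    have h := vertexElement_smul_smul (vacuum 0)
      (wedge (fun j => annihilate (1 - j)) (fun _ : Fin 1 => (k : ℤ)) (vacuum 1)) 0 k α β
    rw [pow_zero, one_smul, ← ket_column, vacuum_eq_wedge_annihilate,
      vertexElement_annihilate _ _ _ _ _ fun _ => by omega, Lam_one, Matrix.det_unique,
      Matrix.of_apply, pow_zero, one_mul] at h
    rw [schur, skewSchur_eq, ket_elim0, vacuum_eq_wedge_annihilate]
    exact h
  -- For k < 0 the convention e_k = 0 agrees with the vanishing of E below the diagonal.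
  · rw [holeExp, matExp_eq_zero _ (not_le.1 hk), mul_zero, mul_zero]

/-- The exponential cancels the vacuum factor of h_k at charge -1, leaving a bare entry of E, now in
row c. -/
theorem pExp_xi_mul_hFun_shift (α β : ℤ → ℂ) (c k : ℤ) :
    pExp (xi (β c)) * hFun k (shift c α) (shift c β) = particleExp α β c (k + c) := by
  have h : shift c β 0 = β c := by simp [shift]
  rw [hFun_eq, h, ← mul_assoc, mul_comm (pExp (xi (β c))), pExp_neg_xi_mul_pExp_xi, one_mul,
    particleExp_shift, zero_add]

theorem pExp_neg_xi_mul_eFun_shift (α β : ℤ → ℂ) (c k : ℤ) :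
    pExp (-xi (β (c + 1))) * eFun k (shift c α) (shift c β) =
      (-1) ^ k.toNat * holeExp α β (-c) (k - c) := by
  have h : shift c β 1 = β (c + 1) := by rw [shift, add_comm]
  rw [eFun_eq, h, holeExp_shift, zero_sub, mul_left_comm, ← mul_assoc (pExp (-xi (β (c + 1)))),
    pExp_neg_xi_mul_pExp_xi, one_mul]

/-! ### The two determinant formulas -/

theorem skewSchur_eq_det_hFun (α β : ℤ → ℂ) (l u : YoungDiagram) (n : ℕ) (hl : l.colLen 0 ≤ n)
    (hu : u.colLen 0 ≤ n) : skewSchur (parts l) (parts u) α β =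
      pExp (Lam β (-(n : ℤ))) * Matrix.det (Matrix.of fun i j : Fin n =>
        pExp (xi (β ((u.rowLen j : ℤ) - (j : ℕ)))) *
          hFun ((l.rowLen i : ℤ) - (u.rowLen j : ℤ) - (i : ℕ) + (j : ℕ))
            (shift ((u.rowLen j : ℤ) - (j : ℕ)) α) (shift ((u.rowLen j : ℤ) - (j : ℕ)) β)) := by
  -- Padding with zero parts puts both partitions over the same vacuum, of charge -n.
  rw [skewSchur_eq, ket_parts, ket_parts, ← wedge_rows l hl, ← wedge_rows u hu,
    vertexElement_create _ _ _ _ _ fun j => by have := j.2; omega]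
  congr 3
  funext i j
  rw [pExp_xi_mul_hFun_shift]
  congr 1
  ring

theorem skewSchur_eq_det_eFun (α β : ℤ → ℂ) (l u : YoungDiagram) (n : ℕ) (hl : l.rowLen 0 ≤ n)
    (hu : u.rowLen 0 ≤ n) : skewSchur (parts l) (parts u) α β =
      pExp (Lam β (n : ℤ)) * Matrix.det (Matrix.of fun i j : Fin n =>
        pExp (-xi (β (((j : ℕ) : ℤ) + 1 - (u.colLen j : ℤ)))) *
          eFun ((l.colLen i : ℤ) - (u.colLen j : ℤ) - (i : ℕ) + (j : ℕ))
            (shift (((j : ℕ) : ℤ) - (u.colLen j : ℤ)) α)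
            (shift (((j : ℕ) : ℤ) - (u.colLen j : ℤ)) β)) := by
  have hsign : ∀ p : ℕ, (-1 : ℂ) ^ p * (-1) ^ p = 1 := fun p => by rw [← mul_pow]; simp
  have hket : ∀ v : YoungDiagram, v.rowLen 0 ≤ n → ket (parts v) =
      (-1 : ℂ) ^ (∑ i : Fin n, v.colLen i) • wedge (fun j => annihilate (1 - j))
        (fun i : Fin n => (v.colLen i : ℤ) - (i : ℕ)) (vacuum (n : ℤ)) := by
    intro v hv
    rw [wedge_columns v hv, smul_smul, hsign, one_smul, ket_parts]
  -- The sign of e_k splits into a row sign and a column sign. For negative k, where `toNat` loses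
  -- the parity, the entry of E is zero.
  have hentry : ∀ i j : Fin n, pExp (-xi (β (((j : ℕ) : ℤ) + 1 - (u.colLen j : ℤ)))) *
      eFun ((l.colLen i : ℤ) - (u.colLen j : ℤ) - (i : ℕ) + (j : ℕ))
        (shift (((j : ℕ) : ℤ) - (u.colLen j : ℤ)) α)
        (shift (((j : ℕ) : ℤ) - (u.colLen j : ℤ)) β) =
      (-1) ^ (l.colLen i + (i : ℕ)) * ((-1) ^ (u.colLen j + (j : ℕ)) *
        holeExp α β ((u.colLen j : ℤ) - (j : ℕ)) ((l.colLen i : ℤ) - (i : ℕ))) := by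
    intro i j
    have h1 : ((j : ℕ) : ℤ) + 1 - (u.colLen j : ℤ) = (j : ℕ) - (u.colLen j : ℤ) + 1 := by ring
    have h2 : (l.colLen i : ℤ) - (u.colLen j : ℤ) - (i : ℕ) + (j : ℕ) -
        ((j : ℕ) - (u.colLen j : ℤ)) = (l.colLen i : ℤ) - (i : ℕ) := by ring
    rw [h1, pExp_neg_xi_mul_eFun_shift, h2, neg_sub, ← mul_assoc, ← pow_add]
    rcases lt_or_ge ((l.colLen i : ℤ) - (i : ℕ)) ((u.colLen j : ℤ) - (j : ℕ)) with h | h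
    · rw [holeExp, matExp_eq_zero _ h, mul_zero, mul_zero]
    · congr 1
      refine neg_one_pow_congr ?_
      rw [Nat.even_iff, Nat.even_iff]
      omega
  rw [skewSchur_eq, hket l hl, hket u hu, vertexElement_smul_smul,
    vertexElement_annihilate _ _ _ _ _ fun j => by have := j.2; omega]
  simp only [hentry]
  have hdet : ∀ (x y : Fin n → MvPowerSeries ℕ+ ℂ) (M : Fin n → Fin n → MvPowerSeries ℕ+ ℂ),
      (Matrix.of fun i j => x i * (y j * M i j)).det =
        (∏ i, x i) * ((∏ j, y j) * (Matrix.of M).det) := by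
    intro x y M
    rw [← Matrix.det_mul_row, ← Matrix.det_mul_column]
    rfl
  rw [hdet]
  simp only [pow_add, prod_mul_distrib, prod_pow_eq_pow_sum]
  -- The signs (-1)^i of the rows and (-1)^j of the columns cancel, and the remaining ones, (-1)^|λ|
  -- and (-1)^|μ|, are those of the hole wedges.
  have h : ((-1 : MvPowerSeries ℕ+ ℂ) ^ ∑ i : Fin n, (i : ℕ)) * (-1) ^ ∑ i : Fin n, (i : ℕ) = 1 := by
    rw [← mul_pow]
    simp
  linear_combination (-(-1 : MvPowerSeries ℕ+ ℂ) ^ (∑ i : Fin n, u.colLen i) *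
    (-1) ^ (∑ i : Fin n, l.colLen i) * pExp (Lam β n) * (Matrix.of fun i j : Fin n =>
      holeExp α β ((u.colLen j : ℤ) - (j : ℕ)) ((l.colLen i : ℤ) - (i : ℕ))).det) * h

end DoubleFactorial

end

theorem mainTheorem6 (α β : ℤ → ℂ) (l u : YoungDiagram) (n : ℕ) :
    (l.colLen 0 ≤ n → u.colLen 0 ≤ n →
      DoubleFactorial.skewSchur (DoubleFactorial.parts l) (DoubleFactorial.parts u) α β =
        DoubleFactorial.pExp (DoubleFactorial.Lam β (-(n : ℤ))) *
          Matrix.det (Matrix.of fun i j : Fin n =>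
            DoubleFactorial.pExp (DoubleFactorial.xi (β ((u.rowLen j : ℤ) - (j : ℕ)))) *
              DoubleFactorial.hFun
                ((l.rowLen i : ℤ) - (u.rowLen j : ℤ) - (i : ℕ) + (j : ℕ))
                (DoubleFactorial.shift ((u.rowLen j : ℤ) - (j : ℕ)) α)
                (DoubleFactorial.shift ((u.rowLen j : ℤ) - (j : ℕ)) β))) ∧
    (l.rowLen 0 ≤ n → u.rowLen 0 ≤ n →
      DoubleFactorial.skewSchur (DoubleFactorial.parts l) (DoubleFactorial.parts u) α β =
        DoubleFactorial.pExp (DoubleFactorial.Lam β (n : ℤ)) *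
          Matrix.det (Matrix.of fun i j : Fin n =>
            DoubleFactorial.pExp
                (-DoubleFactorial.xi (β (((j : ℕ) : ℤ) + 1 - (u.colLen j : ℤ)))) *
              DoubleFactorial.eFun
                ((l.colLen i : ℤ) - (u.colLen j : ℤ) - (i : ℕ) + (j : ℕ))
                (DoubleFactorial.shift (((j : ℕ) : ℤ) - (u.colLen j : ℤ)) α)
                (DoubleFactorial.shift (((j : ℕ) : ℤ) - (u.colLen j : ℤ)) β))) :=
  ⟨DoubleFactorial.skewSchur_eq_det_hFun α β l u n, DoubleFactorial.skewSchur_eq_det_eFun α β l u n⟩
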